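/- Let $n\ge 2$, let $\Omega\subset\mathbb R^n$ be a bounded domain of class $C^{1,1}$, and let $n/2<q<\infty$. For a continuous function $v:\Omega\to\mathbb R$ and $x\in\Omega$ let $\overline\Theta(v,\Omega)(x)\in[0,\infty]$ be the infimum of all $M>0$ for which there is a convex paraboloid of opening $M$, that is, a polynomial $P(y)=l_0+l(y)+\frac M2|y|^2$ with $l_0\in\mathbb R$ and $l$ linear, that touches $v$ by above at $x$ in $\Omega$, i.e. $v\le P$ in $\Omega$ and $v(x)=P(x)$ (the infimum is $+\infty$ if there is no such $M$). Let $\underline\Theta(v,\Omega)(x)$ be the infimum of all $M>0$ for which there is a concave paraboloid $P(y)=l_0+l(y)-\frac M2|y|^2$ that touches $v$ by below at $x$ in $\Omega$, i.e. $P\le v$ in $\Omega$ and $v(x)=P(x)$, with the same convention. Put $\Theta(v,\Omega)=\max\{\overline\Theta(v,\Omega),\underline\Theta(v,\Omega)\}$. Then there is a constant $C$, depending only on $n$, $q$ and $\Omega$, such that every $u\in W^{2,q}(\Omega)$ has a continuous representative in $\Omega$ and, with $u$ denoting this representative, $\Theta(u,\Omega)\in L^q(\Omega)$ and $$\|\Theta(u,\Omega)\|_{L^q(\Omega)}\le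 C\,\|u\|_{W^{2,q}(\Omega)}.$$ -/

import Mathlib

open MeasureTheory TopologicalSpace
open scoped ENNReal NNReal Distributions RealInnerProductSpace

namespace ThetaOpening

/-! ### Bounded domains of class `C^{1,1}` -/

/-- `Ω ⊆ ℝⁿ` is a bounded domain (nonempty, connected, open) of class `C^{1,1}`: near each of its
boundary points it is, for some unit vector `ν`, the region above the graph of a `C^{1,1}` function
`γ` over the hyperplane `ν^⊥`. The point `x - ⟪ν, x⟫ • ν` is the orthogonal projection of `x` onto
`ν^⊥`, so only the values of `γ` on that hyperplane matter. -/
structure IsBoundedC11Domain {n : ℕ} (Ω : Set (EuclideanSpace ℝ (Fin n))) : Prop where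
  isOpen : IsOpen Ω
  isConnected : IsConnected Ω
  isBounded : Bornology.IsBounded Ω
  boundary : ∀ x₀ ∈ frontier Ω, ∃ r : ℝ, 0 < r ∧
    ∃ (ν : EuclideanSpace ℝ (Fin n)) (γ : EuclideanSpace ℝ (Fin n) → ℝ) (K : ℝ≥0),
      ‖ν‖ = 1 ∧ ContDiff ℝ 1 γ ∧ LipschitzWith K (fderiv ℝ γ) ∧
      ∀ x ∈ Metric.ball x₀ r, x ∈ Ω ↔ γ (x - ⟪ν, x⟫ • ν) < ⟪ν, x⟫

/-! ### Weak derivatives and Sobolev spaces on an open set -/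

/-- The classical partial derivative `∂_{I 0} ⋯ ∂_{I (k-1)} φ` of a smooth function. -/
noncomputable def partialDeriv {n k : ℕ} (I : Fin k → Fin n)
    (φ : EuclideanSpace ℝ (Fin n) → ℝ) (x : EuclideanSpace ℝ (Fin n)) : ℝ :=
  iteratedFDeriv ℝ k φ x (fun j => EuclideanSpace.single (I j) 1)

/-- `g` is the weak partial derivative `∂_{I 0} ⋯ ∂_{I (k-1)} u` in `Ω`: both are locally
integrable in `Ω` and `∫_Ω u ∂_I φ = (-1)^k ∫_Ω g φ` for all `φ ∈ C_c^∞(Ω)`. -/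
def HasWeakDeriv {n k : ℕ} (Ω : Opens (EuclideanSpace ℝ (Fin n))) (I : Fin k → Fin n)
    (u g : EuclideanSpace ℝ (Fin n) → ℝ) : Prop :=
  LocallyIntegrableOn u Ω ∧ LocallyIntegrableOn g Ω ∧
    ∀ φ : 𝓓(Ω, ℝ), ∫ x in Ω, u x * partialDeriv I φ x = (-1) ^ k * ∫ x in Ω, g x * φ x

/-- Weak partial derivatives are unique up to null sets. -/
theorem HasWeakDeriv.ae_eq {n k : ℕ} {Ω : Opens (EuclideanSpace ℝ (Fin n))} {I : Fin k → Fin n}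
    {u g h : EuclideanSpace ℝ (Fin n) → ℝ} (hg : HasWeakDeriv Ω I u g)
    (hh : HasWeakDeriv Ω I u h) : g =ᵐ[volume.restrict Ω] h := by
  have key : ∀ᵐ x, x ∈ (Ω : Set (EuclideanSpace ℝ (Fin n))) → (g - h) x = 0 := by
    refine Ω.isOpen.ae_eq_zero_of_integral_contDiff_smul_eq_zero (hg.2.1.sub hh.2.1) ?_
    intro φ hφ hc hs
    have e := (hg.2.2 ⟨φ, hφ, hc, hs⟩).symm.trans (hh.2.2 ⟨φ, hφ, hc, hs⟩)
    have e' : ∫ x in Ω, g x * φ x = ∫ x in Ω, h x * φ x :=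
      mul_left_cancel₀ (pow_ne_zero k (by norm_num)) e
    have conv : ∀ f : EuclideanSpace ℝ (Fin n) → ℝ,
        ∫ x in Ω, f x * φ x = ∫ x, φ x • f x := by
      intro f
      rw [setIntegral_eq_integral_of_forall_compl_eq_zero]
      · simp [mul_comm]
      · intro x hx
        have : φ x = 0 := image_eq_zero_of_notMem_tsupport fun h => hx (hs h)
        simp [this]
    have int : ∀ f : EuclideanSpace ℝ (Fin n) → ℝ, LocallyIntegrableOn f Ω →
        Integrable fun x => φ x • f x := by
      intro f hf
      refine (integrableOn_iff_integrable_of_support_subset (s := tsupport φ) ?_).1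
        ((hf.integrableOn_compact_subset hs hc).continuousOn_smul hφ.continuous.continuousOn hc)
      exact (Function.support_smul_subset_left _ _).trans (subset_tsupport φ)
    simp only [Pi.sub_apply, smul_sub]
    rw [integral_sub (int g hg.2.1) (int h hh.2.1), ← conv, ← conv, e', sub_self]
  refine (ae_restrict_iff' Ω.isOpen.measurableSet).2 ?_
  filter_upwards [key] with x hx hxΩ
  exact sub_eq_zero.1 (hx hxΩ)

/-- `u ∈ W^{m,p}(Ω)`: all weak partial derivatives of order at most `m` (including `u` itself,
`k = 0`) exist and belong to `L^p(Ω)`. -/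
def MemSobolev {n : ℕ} (Ω : Opens (EuclideanSpace ℝ (Fin n))) (m : ℕ) (p : ℝ≥0∞)
    (u : EuclideanSpace ℝ (Fin n) → ℝ) : Prop :=
  ∀ k ≤ m, ∀ I : Fin k → Fin n, ∃ g, HasWeakDeriv Ω I u g ∧ MemLp g p (volume.restrict Ω)

open Classical in
/-- The weak partial derivative `∂_{I 0} ⋯ ∂_{I (k-1)} u` in `Ω` (`0` if there is none). -/
noncomputable def weakDeriv {n k : ℕ} (Ω : Opens (EuclideanSpace ℝ (Fin n))) (I : Fin k → Fin n)
    (u : EuclideanSpace ℝ (Fin n) → ℝ) : EuclideanSpace ℝ (Fin n) → ℝ :=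
  if h : ∃ g, HasWeakDeriv Ω I u g then h.choose else 0

/-- The norm `‖u‖_{W^{m,p}(Ω)}`: the sum of the `L^p(Ω)` norms of all weak partial derivatives
`u`, `∂_i u`, `∂_i ∂_j u`, … of order at most `m`. -/
noncomputable def sobolevNorm {n : ℕ} (Ω : Opens (EuclideanSpace ℝ (Fin n))) (m : ℕ) (p : ℝ≥0∞)
    (u : EuclideanSpace ℝ (Fin n) → ℝ) : ℝ≥0∞ :=
  ∑ k ∈ Finset.range (m + 1), ∑ I : Fin k → Fin n, eLpNorm (weakDeriv Ω I u) p (volume.restrict Ω)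

/-! ### Touching paraboloids and the opening function -/

/-- `P` is a convex paraboloid of opening `M > 0`. -/
def IsConvexParaboloid {n : ℕ} (M : ℝ) (P : EuclideanSpace ℝ (Fin n) → ℝ) : Prop :=
  0 < M ∧ ∃ (l₀ : ℝ) (l : EuclideanSpace ℝ (Fin n) →ₗ[ℝ] ℝ),
    ∀ x, P x = l₀ + l x + M / 2 * ‖x‖ ^ 2

/-- `P` is a concave paraboloid of opening `M > 0`. -/
def IsConcaveParaboloid {n : ℕ} (M : ℝ) (P : EuclideanSpace ℝ (Fin n) → ℝ) : Prop :=
  0 < M ∧ ∃ (l₀ : ℝ) (l : EuclideanSpace ℝ (Fin n) →ₗ[ℝ] ℝ),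
    ∀ x, P x = l₀ + l x - M / 2 * ‖x‖ ^ 2

/-- `v` touches `u` by above at `x₀` in `Ω`. -/
def TouchesAbove {n : ℕ} (Ω : Set (EuclideanSpace ℝ (Fin n)))
    (v u : EuclideanSpace ℝ (Fin n) → ℝ) (x₀ : EuclideanSpace ℝ (Fin n)) : Prop :=
  (∀ x ∈ Ω, u x ≤ v x) ∧ u x₀ = v x₀

/-- `v` touches `u` by below at `x₀` in `Ω`. -/
def TouchesBelow {n : ℕ} (Ω : Set (EuclideanSpace ℝ (Fin n)))
    (v u : EuclideanSpace ℝ (Fin n) → ℝ) (x₀ : EuclideanSpace ℝ (Fin n)) : Prop :=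
  (∀ x ∈ Ω, v x ≤ u x) ∧ u x₀ = v x₀

/-- The infimum of the openings of the convex paraboloids touching `u` by above at `x` in `Ω`;
it is `∞` if there are none. -/
noncomputable def upperTheta {n : ℕ} (u : EuclideanSpace ℝ (Fin n) → ℝ)
    (Ω : Set (EuclideanSpace ℝ (Fin n))) (x : EuclideanSpace ℝ (Fin n)) : ℝ≥0∞ :=
  sInf {t | ∃ (M : ℝ) (P : EuclideanSpace ℝ (Fin n) → ℝ),
    IsConvexParaboloid M P ∧ TouchesAbove Ω P u x ∧ t = ENNReal.ofReal M}

/-- The infimum of the openings of the concave paraboloids touching `u` by below at `x` in `Ω`;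
it is `∞` if there are none. -/
noncomputable def lowerTheta {n : ℕ} (u : EuclideanSpace ℝ (Fin n) → ℝ)
    (Ω : Set (EuclideanSpace ℝ (Fin n))) (x : EuclideanSpace ℝ (Fin n)) : ℝ≥0∞ :=
  sInf {t | ∃ (M : ℝ) (P : EuclideanSpace ℝ (Fin n) → ℝ),
    IsConcaveParaboloid M P ∧ TouchesBelow Ω P u x ∧ t = ENNReal.ofReal M}

/-- The opening function `Θ(u, Ω)`. -/
noncomputable def Theta {n : ℕ} (u : EuclideanSpace ℝ (Fin n) → ℝ)
    (Ω : Set (EuclideanSpace ℝ (Fin n))) (x : EuclideanSpace ℝ (Fin n)) : ℝ≥0∞ :=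
  max (upperTheta u Ω x) (lowerTheta u Ω x)

end ThetaOpening

/-! Fix `p` with `n/2 < p < q`; then `1 < p`, since `n ≥ 2`. Write `M` for the maximal function and
`M_p F = (M (F ^ p)) ^ (1/p)`. The heart of the proof is the estimate, for almost all nearby `x, y`
in `Ω`, `|u y - u x - ∇u(x)·(y - x)| ≤ C |y - x|² M_p(M |D²u|)(x)`, with `D²u` extended by zero. Its
coefficient lies in `L^q`, because `M` is bounded on `L^q` and on `L^(q/p)`.

For a smooth `f` the estimate comes from averaging over a third point `b`
(`exists_enorm_sub_sub_fderiv_le_maximalFunction`). By `exists_common_ball`, both `x` and `y` see a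
ball of radius `|x - y|` through segments inside `Ω`. Expanding `f x` and `f y` about `b` and
comparing the gradients at `b` and `x` leaves integrals of `D²f` along these segments. Averaged over
`b`, the point at parameter `s` sweeps a ball of radius `s |x - y|`. On the `y` side the comparison
with a fixed ball about `x` costs `s ^ (-n/p)`, and the Taylor weight `s` makes this integrable
since `n/p < 2`; on the `x` side the balls shrink to `x` and nothing is lost. Mollifications of `u`
satisfy the estimate with Hessians bounded by `M |D²u|` near the segments, and it passes to the
limit on a set `G` of full measure (`exists_taylor`).

The rest uses only these expansions, with coefficient `A` in `L^q`. As `q > n/2`, there are points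
`x` arbitrarily near any given point, say within `ρ`, at which `A x * ρ²` is small, so `u` has
limits along `G` and a continuous representative (`exists_tendsto`). Averaging the expansions in `x`
bounds this representative uniformly (`mul_enorm_le`). At distant points the sup bound and the
gradient replace the expansion, so almost every point has touching paraboloids on both sides whose
opening is controlled in `L^q` (`ae_Theta_le`). Measurability of the opening function follows from
its lower semicontinuity in `Ω`. -/

namespace ThetaOpening

open Metric Set Filter Topology
open scoped Convolution

/-! ### The Hardy-Littlewood maximal function -/

section Maximal

variable {E : Type*} [NormedAddCommGroup E] [MeasurableSpace E]

/-- The uncentered Hardy-Littlewood maximal function. -/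
noncomputable def maximalFunction (μ : Measure E) (F : E → ℝ≥0∞) (x : E) : ℝ≥0∞ :=
  ⨆ (c : E) (r : ℝ), (ball c r).indicator (fun _ => (μ (ball c r))⁻¹ * ∫⁻ y in ball c r, F y ∂μ) x

/-- With uncentered open balls, this is a supremum of constants times indicators of open sets; hence
measurability needs nothing of `F`. -/
theorem lowerSemicontinuous_maximalFunction (μ : Measure E) (F : E → ℝ≥0∞) :
    LowerSemicontinuous (maximalFunction μ F) :=
  lowerSemicontinuous_iSup fun _ => lowerSemicontinuous_iSup fun _ =>
    isOpen_ball.lowerSemicontinuous_indicator zero_le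

theorem measurable_maximalFunction [BorelSpace E] (μ : Measure E) (F : E → ℝ≥0∞) :
    Measurable (maximalFunction μ F) :=
  (lowerSemicontinuous_maximalFunction μ F).measurable

theorem average_le_maximalFunction (μ : Measure E) (F : E → ℝ≥0∞) {x c : E} {r : ℝ}
    (hx : x ∈ ball c r) :
    (μ (ball c r))⁻¹ * ∫⁻ y in ball c r, F y ∂μ ≤ maximalFunction μ F x := by
  refine le_iSup_of_le c (le_iSup_of_le r ?_)
  rw [indicator_of_mem hx]

theorem maximalFunction_mono (μ : Measure E) {F G : E → ℝ≥0∞} (h : ∀ x, F x ≤ G x) (x : E) :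
    maximalFunction μ F x ≤ maximalFunction μ G x := by
  refine iSup_mono fun c => iSup_mono fun r => indicator_le_indicator ?_
  gcongr with y
  exact h y

theorem lt_maximalFunction_iff {μ : Measure E} {F : E → ℝ≥0∞} {t : ℝ≥0∞} {x : E} :
    t < maximalFunction μ F x ↔
      ∃ c r, x ∈ ball c r ∧ t < (μ (ball c r))⁻¹ * ∫⁻ y in ball c r, F y ∂μ := by
  simp only [maximalFunction, lt_iSup_iff]
  refine exists_congr fun c => exists_congr fun r => ?_
  by_cases hx : x ∈ ball c r
  · simp [hx]
  · simp [hx]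

theorem setLIntegral_ball_le_maximalFunction [ProperSpace E] (μ : Measure E)
    [μ.IsOpenPosMeasure] [IsFiniteMeasureOnCompacts μ] (F : E → ℝ≥0∞) {x c : E} {r : ℝ}
    (hx : x ∈ ball c r) :
    ∫⁻ y in ball c r, F y ∂μ ≤ μ (ball c r) * maximalFunction μ F x := by
  have hr : 0 < r := pos_of_mem_ball hx
  have h := average_le_maximalFunction μ F hx
  rwa [ENNReal.inv_mul_le_iff (measure_ball_pos μ c hr).ne' measure_ball_lt_top.ne] at h

variable [NormedSpace ℝ E] [FiniteDimensional ℝ E] [BorelSpace E]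
  (μ : Measure E) [μ.IsAddHaarMeasure]

/-- The weak type `(1,1)` bound. -/
theorem mul_measure_lt_maximalFunction_le [Nontrivial E] (F : E → ℝ≥0∞) (t : ℝ≥0∞) :
    t * μ {x | t < maximalFunction μ F x} ≤
      ENNReal.ofReal (4 ^ Module.finrank ℝ E) * ∫⁻ x, F x ∂μ := by
  set d := Module.finrank ℝ E with hd
  have hd0 : d ≠ 0 := Module.finrank_pos.ne'
  rcases eq_or_ne t 0 with rfl | ht
  · simp
  rcases eq_or_ne t ⊤ with rfl | ht'
  · simp
  rcases eq_or_ne (∫⁻ x, F x ∂μ) ⊤ with hF | hF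
  · rw [hF, ENNReal.mul_top (by simp)]
    exact le_top
  let T : Set (E × ℝ) := {a | 0 < a.2 ∧ t * μ (ball a.1 a.2) ≤ ∫⁻ y in ball a.1 a.2, F y ∂μ}
  have hcov : {x | t < maximalFunction μ F x} ⊆ ⋃ a ∈ T, ball a.1 a.2 := by
    intro x hx
    obtain ⟨c, r, hxc, h⟩ := lt_maximalFunction_iff.1 hx
    have hr : 0 < r := pos_of_mem_ball hxc
    refine mem_biUnion (x := (c, r)) ⟨hr, ?_⟩ hxc
    have h' := h.le
    rwa [mul_comm _ (∫⁻ y in ball c r, F y ∂μ), ← div_eq_mul_inv, ENNReal.le_div_iff_mul_le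
      (Or.inl (measure_ball_pos μ c hr).ne') (Or.inl measure_ball_lt_top.ne)] at h'
  set B := (∫⁻ x, F x ∂μ) / t / μ (ball 0 1) with hB
  have hB' : B ≠ ⊤ := (ENNReal.div_lt_top
    (ENNReal.div_lt_top hF ht).ne (measure_ball_pos μ 0 one_pos).ne').ne
  -- The Vitali covering lemma needs bounded radii: the finite mass of `F` bounds the measure, hence
  -- the radius, of every ball in `T`.
  have hR : ∀ a ∈ T, a.2 ≤ max 1 B.toReal := by
    rintro ⟨c, r⟩ ⟨hr, h⟩
    rcases le_total r 1 with h1 | h1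
    · exact le_max_of_le_left h1
    refine le_max_of_le_right ?_
    have h2 : ENNReal.ofReal (r ^ d) ≤ B := by
      rw [hB, ENNReal.le_div_iff_mul_le (Or.inl (measure_ball_pos μ 0 one_pos).ne')
        (Or.inl measure_ball_lt_top.ne), ← Measure.addHaar_ball_of_pos μ c hr,
        ENNReal.le_div_iff_mul_le (Or.inl ht) (Or.inl ht'), mul_comm]
      exact h.trans (setLIntegral_le_lintegral _ _)
    calc r ≤ r ^ d := le_self_pow₀ h1 hd0
      _ ≤ B.toReal := (ENNReal.ofReal_le_iff_le_toReal hB').1 h2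
  -- Any enlargement factor above 3 would do; 4 is the source of the constant `4 ^ d`.
  obtain ⟨u, huT, hdisj, hu⟩ := Vitali.exists_disjoint_subfamily_covering_enlargement_ball
    T (fun a => a.1) (fun a => a.2) _ hR 4 (by norm_num)
  have hcount : u.Countable := hdisj.countable_of_isOpen (fun a _ => isOpen_ball)
    (fun a ha => nonempty_ball.2 (huT ha).1)
  have hcov2 : {x | t < maximalFunction μ F x} ⊆ ⋃ a ∈ u, ball a.1 (4 * a.2) := by
    refine hcov.trans (iUnion₂_subset fun a ha => ?_)
    obtain ⟨b, hb, hab⟩ := hu a ha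
    exact hab.trans (subset_biUnion_of_mem (u := fun a : E × ℝ => ball a.1 (4 * a.2)) hb)
  have := hcount.to_subtype
  calc t * μ {x | t < maximalFunction μ F x}
      ≤ t * ∑' a : u, μ (ball a.1.1 (4 * a.1.2)) := by
        gcongr
        exact (measure_mono hcov2).trans (measure_biUnion_le μ hcount _)
    _ = ENNReal.ofReal (4 ^ d) * ∑' a : u, t * μ (ball a.1.1 a.1.2) := by
        rw [← ENNReal.tsum_mul_left, ← ENNReal.tsum_mul_left]
        refine tsum_congr fun a => ?_
        rw [Measure.addHaar_ball_mul_of_pos μ _ (by norm_num : (0 : ℝ) < 4),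
          Measure.addHaar_ball_center μ a.1.1]
        ring
    _ ≤ ENNReal.ofReal (4 ^ d) * ∑' a : u, ∫⁻ y in ball a.1.1 a.1.2, F y ∂μ := by
        gcongr with a
        exact (huT a.2).2
    _ = ENNReal.ofReal (4 ^ d) * ∫⁻ y in ⋃ a ∈ u, ball a.1 a.2, F y ∂μ := by
        rw [lintegral_biUnion hcount (fun a _ => measurableSet_ball) hdisj]
    _ ≤ _ := by
        gcongr
        exact Measure.restrict_le_self

/-- The weak type bound for the part of `F` above the height `t / 2`. -/
theorem mul_measure_lt_maximalFunction_le_setLIntegral [Nontrivial E] {F : E → ℝ≥0∞}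
    (hF : Measurable F) (t : ℝ≥0∞) :
    t * μ {x | t < maximalFunction μ F x} ≤
      2 * ENNReal.ofReal (4 ^ Module.finrank ℝ E) * ∫⁻ x in {x | t < 2 * F x}, F x ∂μ := by
  set S := {x | t < 2 * F x} with hS
  have hSm : MeasurableSet S := measurableSet_lt measurable_const (hF.const_mul 2)
  -- The part of `F` below height `t / 2` contributes at most `t / 2` to any average, so the part
  -- above must exceed `t / 2`.
  have hsub : {x | t < maximalFunction μ F x} ⊆
      {x | t / 2 < maximalFunction μ (S.indicator F) x} := by
    intro x hx
    obtain ⟨c, r, hxc, h⟩ := lt_maximalFunction_iff.1 hx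
    have hr : 0 < r := pos_of_mem_ball hxc
    have h0 := (measure_ball_pos μ c hr).ne'
    refine lt_maximalFunction_iff.2 ⟨c, r, hxc, ?_⟩
    have h1 : ∫⁻ y in ball c r, F y ∂μ ≤
        ∫⁻ y in ball c r, S.indicator F y ∂μ + t / 2 * μ (ball c r) := by
      rw [← setLIntegral_const, ← lintegral_add_right _ measurable_const]
      refine lintegral_mono fun y => ?_
      by_cases hy : y ∈ S
      · simp [indicator_of_mem hy]
      · rw [indicator_of_notMem hy, zero_add]
        rw [ENNReal.le_div_iff_mul_le (by simp) (by simp), mul_comm]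
        exact not_lt.1 hy
    have h2 : (μ (ball c r))⁻¹ * ∫⁻ y in ball c r, F y ∂μ ≤
        (μ (ball c r))⁻¹ * ∫⁻ y in ball c r, S.indicator F y ∂μ + t / 2 := by
      refine (mul_le_mul_right h1 _).trans ?_
      rw [mul_add, mul_comm (t / 2), ← mul_assoc, ENNReal.inv_mul_cancel h0
        measure_ball_lt_top.ne, one_mul]
    have h3 := h.trans_le h2
    nth_rewrite 1 [← ENNReal.add_halves t] at h3
    exact lt_of_add_lt_add_right h3
  calc t * μ {x | t < maximalFunction μ F x}
      ≤ t * μ {x | t / 2 < maximalFunction μ (S.indicator F) x} := by gcongr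
    _ = 2 * (t / 2 * μ {x | t / 2 < maximalFunction μ (S.indicator F) x}) := by
        rw [← mul_assoc, ENNReal.mul_div_cancel (by simp) (by simp)]
    _ ≤ 2 * (ENNReal.ofReal (4 ^ Module.finrank ℝ E) * ∫⁻ x, S.indicator F x ∂μ) := by
        exact mul_le_mul_right (mul_measure_lt_maximalFunction_le μ _ _) _
    _ = _ := by rw [lintegral_indicator hSm, mul_assoc]

/-- The layer-cake identity for a single value, `∞` included. -/
theorem lintegral_rpow_sub_one_indicator (h : ℝ≥0∞) {a : ℝ} (ha : 0 < a) :
    ∫⁻ t in Ioi (0 : ℝ), ENNReal.ofReal (t ^ (a - 1)) *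
      {s : ℝ | ENNReal.ofReal s < h}.indicator 1 t = ENNReal.ofReal a⁻¹ * h ^ a := by
  have key : ∀ s : ℝ, 0 ≤ s → ∫⁻ t in Ioo 0 s, ENNReal.ofReal (t ^ (a - 1)) =
      ENNReal.ofReal a⁻¹ * ENNReal.ofReal s ^ a := by
    intro s hs
    rw [← ofReal_integral_eq_lintegral_ofReal]
    · rw [← integral_Ioc_eq_integral_Ioo, ← intervalIntegral.integral_of_le hs,
        integral_rpow (Or.inl (by linarith)), ENNReal.ofReal_rpow_of_nonneg hs ha.le,
        ← ENNReal.ofReal_mul (by positivity)]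
      congr 1
      simp [Real.zero_rpow ha.ne']
      ring
    · rw [← IntegrableOn, ← integrableOn_Ioc_iff_integrableOn_Ioo,
        ← intervalIntegrable_iff_integrableOn_Ioc_of_le hs]
      exact intervalIntegral.intervalIntegrable_rpow' (by linarith)
    · filter_upwards [ae_restrict_mem measurableSet_Ioo] with t ht
      exact Real.rpow_nonneg ht.1.le _
  have hm : MeasurableSet {s : ℝ | ENNReal.ofReal s < h} :=
    measurableSet_lt ENNReal.measurable_ofReal measurable_const
  have e : ∫⁻ t in Ioi (0 : ℝ), ENNReal.ofReal (t ^ (a - 1)) *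
      {s : ℝ | ENNReal.ofReal s < h}.indicator 1 t =
      ∫⁻ t in Ioi (0 : ℝ) ∩ {s : ℝ | ENNReal.ofReal s < h}, ENNReal.ofReal (t ^ (a - 1)) := by
    rw [inter_comm, ← setLIntegral_indicator hm]
    refine lintegral_congr fun t => ?_
    by_cases ht : t ∈ {s : ℝ | ENNReal.ofReal s < h}
    · simp only [indicator_of_mem ht]; simp
    · simp only [indicator_of_notMem ht]; simp
  rw [e]
  rcases eq_or_ne h ⊤ with rfl | hh
  · rw [ENNReal.top_rpow_of_pos ha, ENNReal.mul_top (by simpa using ha)]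
    refine ENNReal.eq_top_of_forall_nnreal_le fun s => ?_
    -- This length makes the truncated integral exactly `s`, so the full integral exceeds every
    -- finite bound.
    have := key ((a * s) ^ a⁻¹) (by positivity)
    rw [ENNReal.ofReal_rpow_of_nonneg (by positivity) ha.le, ← Real.rpow_mul (by positivity),
      inv_mul_cancel₀ ha.ne', Real.rpow_one, ← ENNReal.ofReal_mul (by positivity),
      inv_mul_cancel_left₀ ha.ne', ENNReal.ofReal_coe_nnreal] at this
    rw [← this]
    refine lintegral_mono_set fun t ht => ⟨ht.1, by simp⟩
  · rw [← ENNReal.ofReal_toReal hh, ← key _ ENNReal.toReal_nonneg]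
    congr 2
    ext t
    simp only [mem_inter_iff, mem_Ioi, mem_ofPred_eq, mem_Ioo]
    refine and_congr_right fun ht => ?_
    rw [ENNReal.ofReal_lt_ofReal_iff_of_nonneg ht.le]

/-- The strong type bound for the maximal function. -/
theorem exists_lintegral_maximalFunction_rpow_le [Nontrivial E] {σ : ℝ} (hσ : 1 < σ) :
    ∃ C : ℝ≥0, ∀ F : E → ℝ≥0∞, Measurable F →
      ∫⁻ x, maximalFunction μ F x ^ σ ∂μ ≤ C * ∫⁻ x, F x ^ σ ∂μ := by
  have hσ0 : 0 < σ := by linarith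
  have hσ1 : 0 < σ - 1 := by linarith
  set K := 2 * ENNReal.ofReal (4 ^ Module.finrank ℝ E) with hK
  have hK' : K ≠ ⊤ := by simp [hK, ENNReal.mul_eq_top]
  set K2 := ENNReal.ofReal σ * (K * (ENNReal.ofReal (σ - 1)⁻¹ * 2 ^ (σ - 1))) with hK2
  have hK2' : K2 ≠ ⊤ := by
    refine ENNReal.mul_ne_top (by simp) (ENNReal.mul_ne_top hK' (ENNReal.mul_ne_top (by simp) ?_))
    exact ENNReal.rpow_ne_top_of_nonneg hσ1.le (by simp)
  refine ⟨K2.toNNReal, fun F hF => ?_⟩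
  rw [ENNReal.coe_toNNReal hK2']
  have hind : ∀ G : E → ℝ≥0∞, Measurable G →
      MeasurableSet {z : E × ℝ | ENNReal.ofReal z.2 < G z.1} := fun G hG =>
    measurableSet_lt (ENNReal.measurable_ofReal.comp measurable_snd) (hG.comp measurable_fst)
  -- Layer cake with a weight `w`, by Tonelli. It is used twice: with `w = 1` for the maximal
  -- function, and with `w = F` and exponent `σ - 1` for the truncated weak-type bound.
  have swap : ∀ (w G : E → ℝ≥0∞) (a : ℝ), Measurable w → Measurable G → 0 < a →
      ∫⁻ x, w x * (ENNReal.ofReal a⁻¹ * G x ^ a) ∂μ =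
      ∫⁻ t in Ioi (0 : ℝ), ENNReal.ofReal (t ^ (a - 1)) *
        ∫⁻ x in {x | ENNReal.ofReal t < G x}, w x ∂μ := by
    intro w G a hw hG ha
    have hm : Measurable fun z : E × ℝ => w z.1 * (ENNReal.ofReal (z.2 ^ (a - 1)) *
        {s : ℝ | ENNReal.ofReal s < G z.1}.indicator 1 z.2) := by
      refine (hw.comp measurable_fst).mul (Measurable.mul (by fun_prop) ?_)
      exact (measurable_const (a := (1 : ℝ≥0∞))).indicator (hind G hG)
    calc _ = ∫⁻ x, (∫⁻ t in Ioi (0 : ℝ), w x * (ENNReal.ofReal (t ^ (a - 1)) *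
        {s : ℝ | ENNReal.ofReal s < G x}.indicator 1 t)) ∂μ := by
          refine lintegral_congr fun x => ?_
          rw [lintegral_const_mul, lintegral_rpow_sub_one_indicator _ ha]
          refine Measurable.mul (by fun_prop) (measurable_one.indicator ?_)
          exact measurableSet_lt ENNReal.measurable_ofReal measurable_const
      _ = ∫⁻ t in Ioi (0 : ℝ), ∫⁻ x, w x * (ENNReal.ofReal (t ^ (a - 1)) *
        {s : ℝ | ENNReal.ofReal s < G x}.indicator 1 t) ∂μ :=
          lintegral_lintegral_swap hm.aemeasurable
      _ = _ := by
          refine lintegral_congr fun t => ?_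
          rw [← lintegral_indicator (measurableSet_lt measurable_const hG),
            ← lintegral_const_mul _ (hw.indicator (measurableSet_lt measurable_const hG))]
          refine lintegral_congr fun x => ?_
          by_cases hx : ENNReal.ofReal t < G x
          · simp [indicator, hx, mul_comm]
          · simp [indicator, hx]
  have h1 := swap 1 (maximalFunction μ F) σ measurable_one (measurable_maximalFunction μ F) hσ0
  have h2 := swap F (fun x => 2 * F x) (σ - 1) hF (hF.const_mul 2) hσ1
  have h3 : ∫⁻ x, maximalFunction μ F x ^ σ ∂μ = ENNReal.ofReal σ *
      ∫⁻ x, (1 : E → ℝ≥0∞) x * (ENNReal.ofReal σ⁻¹ * maximalFunction μ F x ^ σ) ∂μ := by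
    rw [← lintegral_const_mul _ (by
      exact measurable_one.mul (((measurable_maximalFunction μ F).pow_const σ).const_mul _))]
    refine lintegral_congr fun x => ?_
    rw [Pi.one_apply, one_mul, ← mul_assoc, ← ENNReal.ofReal_mul hσ0.le,
      mul_inv_cancel₀ hσ0.ne', ENNReal.ofReal_one, one_mul]
  have h4 : K2 * ∫⁻ x, F x ^ σ ∂μ = ENNReal.ofReal σ * (K *
      ∫⁻ x, F x * (ENNReal.ofReal (σ - 1)⁻¹ * (2 * F x) ^ (σ - 1)) ∂μ) := by
    rw [hK2, mul_assoc, mul_assoc, ← lintegral_const_mul _ (hF.pow_const σ)]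
    congr 2
    refine lintegral_congr fun x => ?_
    rw [ENNReal.mul_rpow_of_nonneg _ _ hσ1.le]
    have : F x ^ σ = F x * F x ^ (σ - 1) := by
      nth_rewrite 2 [← ENNReal.rpow_one (F x)]
      rw [← ENNReal.rpow_add_of_nonneg _ _ zero_le_one hσ1.le]
      ring_nf
    rw [this]
    ring
  rw [h3, h4, h1, h2, ← lintegral_const_mul' _ _ hK']
  gcongr ENNReal.ofReal σ * ?_
  -- At each height `t` this is the truncated weak-type bound multiplied by `t ^ (σ - 2)`.
  refine setLIntegral_mono' measurableSet_Ioi fun t ht => ?_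
  have ht0 : (0 : ℝ) < t := ht
  have h5 := mul_measure_lt_maximalFunction_le_setLIntegral μ hF (ENNReal.ofReal t)
  have h6 : ENNReal.ofReal (t ^ (σ - 1)) =
      ENNReal.ofReal (t ^ (σ - 1 - 1)) * ENNReal.ofReal t := by
    rw [← ENNReal.ofReal_mul (by positivity)]
    congr 1
    nth_rewrite 3 [← Real.rpow_one t]
    rw [← Real.rpow_add ht0]
    ring_nf
  calc _ = ENNReal.ofReal (t ^ (σ - 1 - 1)) *
        (ENNReal.ofReal t * μ {x | ENNReal.ofReal t < maximalFunction μ F x}) := by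
        rw [h6, mul_assoc]
        simp
    _ ≤ ENNReal.ofReal (t ^ (σ - 1 - 1)) *
        (K * ∫⁻ x in {x | ENNReal.ofReal t < 2 * F x}, F x ∂μ) := by gcongr
    _ = _ := by ring

end Maximal

/-! ### Two points of a Lipschitz domain see a common ball -/

section Geometry

theorem norm_sub_inner_smul_le {E : Type*} [NormedAddCommGroup E] [InnerProductSpace ℝ E]
    {ν : E} (hν : ‖ν‖ = 1) (e : E) : ‖e - ⟪ν, e⟫ • ν‖ ≤ ‖e‖ := by
  refine abs_le_of_sq_le_sq' ?_ (norm_nonneg _) |>.2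
  rw [norm_sub_sq_real, inner_smul_right, norm_smul, hν, real_inner_comm ν e, Real.norm_eq_abs]
  have : (|⟪ν, e⟫| * 1) ^ 2 = ⟪ν, e⟫ ^ 2 := by rw [mul_one, sq_abs]
  rw [this]
  nlinarith [sq_nonneg ⟪ν, e⟫]

/-- Near a boundary point at which `Ω` is the region above a `C¹` graph, all the points of `Ω` are
vertices of translates of one truncated open cone that lie in `Ω`. -/
theorem exists_cone_condition {E : Type*} [NormedAddCommGroup E] [InnerProductSpace ℝ E]
    {Ω : Set E} {x₀ ν : E} {r : ℝ} {γ : E → ℝ} (hr : 0 < r) (hν : ‖ν‖ = 1)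
    (hγ : ContDiff ℝ 1 γ) (h : ∀ x ∈ ball x₀ r, x ∈ Ω ↔ γ (x - ⟪ν, x⟫ • ν) < ⟪ν, x⟫) :
    ∃ r₁ > 0, ∃ K : ℝ, 0 ≤ K ∧ ∀ x ∈ Ω, x ∈ ball x₀ r₁ → ∀ (t : ℝ) (e : E), 0 ≤ t →
      (K + 1) * ‖e‖ ≤ t → x + t • ν + e ∈ ball x₀ r₁ → x + t • ν + e ∈ Ω := by
  set π : E → E := fun x => x - ⟪ν, x⟫ • ν with hπ
  have hπc : Continuous π := by fun_prop
  -- A local Lipschitz constant of the graph fixes the aperture: moving up by `t` beats the change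
  -- of `γ` plus the loss of height caused by `e`.
  obtain ⟨K, S, hS, hK⟩ := (hγ.contDiffAt (x := π x₀)).exists_lipschitzOnWith
  obtain ⟨r', hr', hsub⟩ := Metric.mem_nhds_iff.1 (hπc.continuousAt.preimage_mem_nhds hS)
  refine ⟨min r r', lt_min hr hr', K, K.2, ?_⟩
  intro x hx hxb t e ht he hw
  have hin : ∀ w ∈ ball x₀ (min r r'), w ∈ ball x₀ r ∧ π w ∈ S := fun w hw =>
    ⟨ball_subset_ball (min_le_left _ _) hw, hsub (ball_subset_ball (min_le_right _ _) hw)⟩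
  have h1 := (h x (hin x hxb).1).1 hx
  refine (h _ (hin _ hw).1).2 ?_
  have hνν : ⟪ν, ν⟫ = 1 := by rw [real_inner_self_eq_norm_sq, hν]; norm_num
  have h2 : ⟪ν, x + t • ν + e⟫ = ⟪ν, x⟫ + t + ⟪ν, e⟫ := by
    rw [inner_add_right, inner_add_right, inner_smul_right, hνν, mul_one]
  have h3 : π (x + t • ν + e) - π x = e - ⟪ν, e⟫ • ν := by
    simp only [hπ, h2]
    module
  have h4 := hK.dist_le_mul _ (hin _ hw).2 _ (hin x hxb).2
  rw [Real.dist_eq, dist_eq_norm, h3] at h4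
  have h5 := (le_abs_self _).trans h4
  have h6 : (K : ℝ) * ‖e - ⟪ν, e⟫ • ν‖ ≤ K * ‖e‖ :=
    mul_le_mul_of_nonneg_left (norm_sub_inner_smul_le hν e) K.2
  have h7 : -‖e‖ ≤ ⟪ν, e⟫ := by
    have := neg_le_of_abs_le (abs_real_inner_le_norm ν e)
    rwa [hν, one_mul] at this
  change γ (π (x + t • ν + e)) < _
  change γ (π x) < _ at h1
  rw [h2]
  linarith

/-- Any two points `x, y` of a bounded domain of class `C^{1,1}` at a small distance see a common
ball of radius `dist x y` whose distance to them is comparable to `dist x y`. -/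
theorem IsBoundedC11Domain.exists_common_ball {n : ℕ} {Ω : Set (EuclideanSpace ℝ (Fin n))}
    (hΩ : IsBoundedC11Domain Ω) :
    ∃ r₀ > 0, ∃ L : ℝ, 0 ≤ L ∧ ∀ x ∈ Ω, ∀ y ∈ Ω, dist x y < r₀ →
      ∃ z, dist x z ≤ L * dist x y ∧
        ∀ b ∈ closedBall z (dist x y), segment ℝ x b ⊆ Ω ∧ segment ℝ y b ⊆ Ω := by
  have hcomp : IsCompact (closure Ω) := hΩ.isBounded.isCompact_closure
  -- Passing to the compact closure allows local constants to be patched by compactness induction.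
  suffices H : ∃ r₀ > 0, ∃ L : ℝ, 0 ≤ L ∧ ∀ x ∈ closure Ω, x ∈ Ω → ∀ y ∈ Ω, dist x y < r₀ →
      ∃ z, dist x z ≤ L * dist x y ∧
        ∀ b ∈ closedBall z (dist x y), segment ℝ x b ⊆ Ω ∧ segment ℝ y b ⊆ Ω by
    obtain ⟨r₀, hr₀, L, hL, H⟩ := H
    exact ⟨r₀, hr₀, L, hL, fun x hx => H x (subset_closure hx) hx⟩
  refine hcomp.induction_on (p := fun S => ∃ r₀ > 0, ∃ L : ℝ, 0 ≤ L ∧ ∀ x ∈ S, x ∈ Ω → ∀ y ∈ Ω,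
    dist x y < r₀ → ∃ z, dist x z ≤ L * dist x y ∧
      ∀ b ∈ closedBall z (dist x y), segment ℝ x b ⊆ Ω ∧ segment ℝ y b ⊆ Ω) ?_ ?_ ?_ ?_
  · exact ⟨1, one_pos, 0, le_rfl, by simp⟩
  · rintro S T hST ⟨r₀, hr₀, L, hL, H⟩
    exact ⟨r₀, hr₀, L, hL, fun x hx => H x (hST hx)⟩
  · rintro S T ⟨r₁, hr₁, L₁, hL₁, H₁⟩ ⟨r₂, hr₂, L₂, hL₂, H₂⟩
    refine ⟨min r₁ r₂, lt_min hr₁ hr₂, max L₁ L₂, le_max_of_le_left hL₁, ?_⟩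
    rintro x (hx | hx) hxΩ y hy hxy
    · obtain ⟨z, hz, h⟩ := H₁ x hx hxΩ y hy (hxy.trans_le (min_le_left _ _))
      exact ⟨z, hz.trans (by gcongr; exact le_max_left _ _), h⟩
    · obtain ⟨z, hz, h⟩ := H₂ x hx hxΩ y hy (hxy.trans_le (min_le_right _ _))
      exact ⟨z, hz.trans (by gcongr; exact le_max_right _ _), h⟩
  · intro x₀ hx₀
    by_cases hx₀Ω : x₀ ∈ Ω
    · obtain ⟨ε, hε, hsub⟩ := Metric.isOpen_iff.1 hΩ.isOpen x₀ hx₀Ω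
      refine ⟨ball x₀ (ε / 2), mem_nhdsWithin_of_mem_nhds (ball_mem_nhds _ (by positivity)),
        ε / 2, by positivity, 0, le_rfl, fun x hx _ y _ hxy => ⟨x, by simp, fun b hb => ?_⟩⟩
      rw [mem_ball] at hx
      rw [mem_closedBall] at hb
      have hx' : x ∈ ball x₀ ε := by rw [mem_ball]; linarith
      have hy' : y ∈ ball x₀ ε := by
        rw [mem_ball]
        have := dist_triangle y x x₀
        rw [dist_comm y x] at this
        linarith
      have hb' : b ∈ ball x₀ ε := by
        rw [mem_ball]
        have := dist_triangle b x x₀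
        linarith
      exact ⟨((convex_ball x₀ ε).segment_subset hx' hb').trans hsub,
        ((convex_ball x₀ ε).segment_subset hy' hb').trans hsub⟩
    · have hfr : x₀ ∈ frontier Ω := by
        rw [frontier, hΩ.isOpen.interior_eq]
        exact ⟨hx₀, hx₀Ω⟩
      obtain ⟨r, hr, ν, γ, -, hν, hγ, -, hgraph⟩ := hΩ.boundary x₀ hfr
      obtain ⟨r₁, hr₁, K, hK, hcone⟩ := exists_cone_condition hr hν hγ hgraph
      -- The ball is centred at height `L * ρ` above `x`. Seen from `y`, a point of it deviates from
      -- the axis by `(b - z) - (y - x)`, of norm at most `2 * ρ`; this `L` keeps that deviation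
      -- within the cone.
      set L := 2 * (K + 1) with hL
      have hL0 : 0 ≤ L := by positivity
      refine ⟨ball x₀ (r₁ / 2), mem_nhdsWithin_of_mem_nhds (ball_mem_nhds _ (by positivity)),
        r₁ / (2 * (L + 3)), by positivity, L, hL0, fun x hx hxΩ y hyΩ hxy => ?_⟩
      set ρ := dist x y with hρ
      have hρ0 : 0 ≤ ρ := dist_nonneg
      have hρ1 : (L + 3) * ρ < r₁ / 2 := by
        rw [lt_div_iff₀ (by positivity)] at hxy
        linarith
      have hyx : ‖y - x‖ = ρ := by rw [hρ, dist_comm, dist_eq_norm]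
      rw [mem_ball, dist_eq_norm] at hx
      refine ⟨x + (L * ρ) • ν, ?_, fun b hb => ?_⟩
      · rw [dist_self_add_right, norm_smul, hν, mul_one, Real.norm_of_nonneg (by positivity)]
      set z := x + (L * ρ) • ν with hz
      rw [mem_closedBall, dist_eq_norm] at hb
      have hzx : ‖z - x‖ = L * ρ := by
        rw [hz, add_sub_cancel_left, norm_smul, hν, mul_one, Real.norm_of_nonneg (by positivity)]
      have hbx : ‖b - x‖ ≤ (L + 1) * ρ := by
        have := norm_sub_le_norm_sub_add_norm_sub b z x
        linarith
      have hball : ∀ w, ‖w - x‖ ≤ (L + 2) * ρ → w ∈ ball x₀ r₁ := fun w hw => by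
        rw [mem_ball, dist_eq_norm]
        have := norm_sub_le_norm_sub_add_norm_sub w x x₀
        linarith
      have hxr : x ∈ ball x₀ r₁ := hball x (by simp; positivity)
      have hyr : y ∈ ball x₀ r₁ := hball y (by rw [hyx]; nlinarith)
      rw [segment_eq_image', segment_eq_image']
      constructor
      · rintro _ ⟨s, ⟨hs0, hs1⟩, rfl⟩
        have e : x + s • (b - x) = x + (s * (L * ρ)) • ν + s • (b - z) := by
          rw [hz]
          module
        have hwb : x + s • (b - x) ∈ ball x₀ r₁ := by
          refine hball _ ?_
          rw [add_sub_cancel_left, norm_smul, Real.norm_of_nonneg hs0]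
          nlinarith [norm_nonneg (b - x)]
        beta_reduce
        rw [e] at hwb ⊢
        refine hcone x hxΩ hxr _ _ (by positivity) ?_ hwb
        rw [norm_smul, Real.norm_of_nonneg hs0]
        calc (K + 1) * (s * ‖b - z‖) ≤ (K + 1) * (s * ρ) := by gcongr
          _ ≤ 2 * ((K + 1) * (s * ρ)) := by
            have : 0 ≤ (K + 1) * (s * ρ) := by positivity
            linarith
          _ = _ := by rw [hL]; ring
      · rintro _ ⟨s, ⟨hs0, hs1⟩, rfl⟩
        have e : y + s • (b - y) = y + (s * (L * ρ)) • ν + s • ((b - z) - (y - x)) := by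
          rw [hz]
          module
        have hwb : y + s • (b - y) ∈ ball x₀ r₁ := by
          refine hball _ ?_
          have : y + s • (b - y) - x = (1 - s) • (y - x) + s • (b - x) := by module
          rw [this]
          refine (norm_add_le _ _).trans ?_
          rw [norm_smul, norm_smul, Real.norm_of_nonneg hs0,
            Real.norm_of_nonneg (sub_nonneg.2 hs1), hyx]
          nlinarith [norm_nonneg (b - x)]
        beta_reduce
        rw [e] at hwb ⊢
        refine hcone y hyΩ hyr _ _ (by positivity) ?_ hwb
        rw [norm_smul, Real.norm_of_nonneg hs0]
        have : ‖(b - z) - (y - x)‖ ≤ 2 * ρ := (norm_sub_le _ _).trans (by linarith)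
        calc (K + 1) * (s * ‖(b - z) - (y - x)‖) ≤ (K + 1) * (s * (2 * ρ)) := by gcongr
          _ = _ := by rw [hL]; ring

end Geometry

/-! ### Taylor estimates averaged over a ball -/

section Taylor

variable {E : Type*} [NormedAddCommGroup E] [NormedSpace ℝ E]

/-- Along the segment from `y` to `b`, with `w = b - y`, the function `f - s * Df(w)` has derivative
`-s * D²f(w, w)`. The expansion is based at `b` but parametrized from `y`, so the weight `s`
vanishes at `y`, where the segments for varying `b` concentrate. -/
theorem enorm_taylor_le {f : E → ℝ} (hf : ContDiff ℝ 2 f) (y b : E) :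
    ‖f y - f b - fderiv ℝ f b (y - b)‖ₑ ≤
      (∫⁻ s in Ioc (0 : ℝ) 1, ENNReal.ofReal s * ‖fderiv ℝ (fderiv ℝ f) (y + s • (b - y))‖ₑ) *
        ‖b - y‖ₑ ^ 2 := by
  have hf1 : ContDiff ℝ 1 (fderiv ℝ f) := hf.fderiv_right (by norm_num)
  have hd : Differentiable ℝ f := hf.differentiable (by norm_num)
  have hd1 : Differentiable ℝ (fderiv ℝ f) := hf1.differentiable (by norm_num)
  have hc2 : Continuous (fderiv ℝ (fderiv ℝ f)) := hf1.continuous_fderiv (by norm_num)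
  set w := b - y with hw
  have hline : ∀ s : ℝ, HasDerivAt (fun s : ℝ => y + s • w) w s := fun s => by
    simpa using ((hasDerivAt_id s).smul_const w).const_add y
  set g' : ℝ → ℝ := fun s => -(s * fderiv ℝ (fderiv ℝ f) (y + s • w) w w) with hg'
  have hg : ∀ s : ℝ, HasDerivAt
      (fun s => f (y + s • w) - s * fderiv ℝ f (y + s • w) w) (g' s) s := by
    intro s
    have h1 := (hd (y + s • w)).hasFDerivAt.comp_hasDerivAt s (hline s)
    have h2 : HasDerivAt (fun s => fderiv ℝ f (y + s • w) w)
        (fderiv ℝ (fderiv ℝ f) (y + s • w) w w) s :=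
      (ContinuousLinearMap.apply ℝ ℝ w).hasFDerivAt.comp_hasDerivAt s
        ((hd1 (y + s • w)).hasFDerivAt.comp_hasDerivAt s (hline s))
    refine (h1.sub ((hasDerivAt_id s).mul h2)).congr_deriv ?_
    simp only [hg', id_eq]
    ring
  have hcont : Continuous g' := by
    have : Continuous fun s : ℝ => fderiv ℝ (fderiv ℝ f) (y + s • w) := by fun_prop
    fun_prop
  have hint := intervalIntegral.integral_eq_sub_of_hasDerivAt (fun s _ => hg s)
    (hcont.intervalIntegrable 0 1)
  have e : f y - f b - fderiv ℝ f b (y - b) = -∫ s in (0 : ℝ)..1, g' s := by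
    rw [hint]
    have h1 : y + (1 : ℝ) • w = b := by rw [hw]; module
    have h2 : fderiv ℝ f b (y - b) = -fderiv ℝ f b w := by rw [← map_neg, hw, neg_sub]
    simp only [h1, h2, zero_smul, add_zero]
    ring
  rw [e, enorm_neg, intervalIntegral.integral_of_le zero_le_one]
  refine (enorm_integral_le_lintegral_enorm _).trans ?_
  rw [← lintegral_mul_const' _ _ (by finiteness)]
  refine setLIntegral_mono' measurableSet_Ioc fun s hs => ?_
  rw [hg', enorm_neg, enorm_mul, mul_assoc, Real.enorm_of_nonneg hs.1.le]
  gcongr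
  calc _ ≤ ‖fderiv ℝ (fderiv ℝ f) (y + s • w) w‖ₑ * ‖w‖ₑ :=
        ContinuousLinearMap.le_opENorm _ _
    _ ≤ ‖fderiv ℝ (fderiv ℝ f) (y + s • w)‖ₑ * ‖w‖ₑ * ‖w‖ₑ := by
        gcongr
        exact ContinuousLinearMap.le_opENorm _ _
    _ = _ := by ring

theorem enorm_fderiv_sub_le {f : E → ℝ} (hf : ContDiff ℝ 2 f) (x b v : E) :
    ‖fderiv ℝ f b v - fderiv ℝ f x v‖ₑ ≤
      (∫⁻ s in Ioc (0 : ℝ) 1, ‖fderiv ℝ (fderiv ℝ f) (x + s • (b - x))‖ₑ) *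
        (‖b - x‖ₑ * ‖v‖ₑ) := by
  have hf1 : ContDiff ℝ 1 (fderiv ℝ f) := hf.fderiv_right (by norm_num)
  have hd1 : Differentiable ℝ (fderiv ℝ f) := hf1.differentiable (by norm_num)
  have hc2 : Continuous (fderiv ℝ (fderiv ℝ f)) := hf1.continuous_fderiv (by norm_num)
  set w := b - x with hw
  have hline : ∀ s : ℝ, HasDerivAt (fun s : ℝ => x + s • w) w s := fun s => by
    simpa using ((hasDerivAt_id s).smul_const w).const_add x
  set g' : ℝ → ℝ := fun s => fderiv ℝ (fderiv ℝ f) (x + s • w) w v with hg'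
  have hg : ∀ s : ℝ, HasDerivAt (fun s => fderiv ℝ f (x + s • w) v) (g' s) s := by
    intro s
    exact (ContinuousLinearMap.apply ℝ ℝ v).hasFDerivAt.comp_hasDerivAt s
      ((hd1 (x + s • w)).hasFDerivAt.comp_hasDerivAt s (hline s))
  have hcont : Continuous g' := by
    have : Continuous fun s : ℝ => fderiv ℝ (fderiv ℝ f) (x + s • w) := by fun_prop
    fun_prop
  have hint := intervalIntegral.integral_eq_sub_of_hasDerivAt (fun s _ => hg s)
    (hcont.intervalIntegrable 0 1)
  have e : fderiv ℝ f b v - fderiv ℝ f x v = ∫ s in (0 : ℝ)..1, g' s := by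
    rw [hint]
    simp [hw]
  rw [e, intervalIntegral.integral_of_le zero_le_one]
  refine (enorm_integral_le_lintegral_enorm _).trans ?_
  rw [← lintegral_mul_const' _ _ (by finiteness)]
  refine setLIntegral_mono' measurableSet_Ioc fun s hs => ?_
  calc _ ≤ ‖fderiv ℝ (fderiv ℝ f) (x + s • w) w‖ₑ * ‖v‖ₑ :=
        ContinuousLinearMap.le_opENorm _ _
    _ ≤ ‖fderiv ℝ (fderiv ℝ f) (x + s • w)‖ₑ * ‖w‖ₑ * ‖v‖ₑ := by
        gcongr
        exact ContinuousLinearMap.le_opENorm _ _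
    _ = _ := by ring

/-- The first order Taylor expansion of `f` at `x`, evaluated at `y`, compared through a third
point `b`. -/
theorem enorm_sub_sub_fderiv_le {f : E → ℝ} (hf : ContDiff ℝ 2 f) {H : E → ℝ≥0∞} {x y b : E}
    {m : ℝ≥0∞} (hx : ∀ s ∈ Icc (0 : ℝ) 1,
      ‖fderiv ℝ (fderiv ℝ f) (x + s • (b - x))‖ₑ ≤ H (x + s • (b - x)))
    (hy : ∀ s ∈ Icc (0 : ℝ) 1,
      ‖fderiv ℝ (fderiv ℝ f) (y + s • (b - y))‖ₑ ≤ H (y + s • (b - y)))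
    (hbx : ‖b - x‖ₑ ≤ m) (hby : ‖b - y‖ₑ ≤ m) (hyx : ‖y - x‖ₑ ≤ m) :
    ‖f y - f x - fderiv ℝ f x (y - x)‖ₑ ≤
      ((∫⁻ s in Ioc (0 : ℝ) 1, ENNReal.ofReal s * H (y + s • (b - y))) +
        2 * ∫⁻ s in Ioc (0 : ℝ) 1, H (x + s • (b - x))) * m ^ 2 := by
  have e : f y - f x - fderiv ℝ f x (y - x) = (f y - f b - fderiv ℝ f b (y - b)) -
      (f x - f b - fderiv ℝ f b (x - b)) + (fderiv ℝ f b (y - x) - fderiv ℝ f x (y - x)) := by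
    have : y - b = (y - x) + (x - b) := by abel
    rw [this, map_add]
    ring
  have h1 : ‖f y - f b - fderiv ℝ f b (y - b)‖ₑ ≤
      (∫⁻ s in Ioc (0 : ℝ) 1, ENNReal.ofReal s * H (y + s • (b - y))) * m ^ 2 := by
    refine (enorm_taylor_le hf y b).trans ?_
    gcongr ?_ * ?_ ^ 2
    refine setLIntegral_mono' measurableSet_Ioc fun s hs => ?_
    gcongr
    exact hy s ⟨hs.1.le, hs.2⟩
  have h2 : ‖f x - f b - fderiv ℝ f b (x - b)‖ₑ ≤
      (∫⁻ s in Ioc (0 : ℝ) 1, H (x + s • (b - x))) * m ^ 2 := by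
    refine (enorm_taylor_le hf x b).trans ?_
    gcongr ?_ * ?_ ^ 2
    refine setLIntegral_mono' measurableSet_Ioc fun s hs => ?_
    -- The weight can be discarded on the segment from `x`, the point at which the maximal function
    -- will be evaluated.
    refine (mul_le_of_le_one_left' ?_).trans (hx s ⟨hs.1.le, hs.2⟩)
    exact ENNReal.ofReal_le_one.2 hs.2
  have h3 : ‖fderiv ℝ f b (y - x) - fderiv ℝ f x (y - x)‖ₑ ≤
      (∫⁻ s in Ioc (0 : ℝ) 1, H (x + s • (b - x))) * m ^ 2 := by
    refine (enorm_fderiv_sub_le hf x b (y - x)).trans ?_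
    rw [pow_two]
    gcongr ?_ * (?_ * ?_)
    exact setLIntegral_mono' measurableSet_Ioc fun s hs => hx s ⟨hs.1.le, hs.2⟩
  rw [e]
  calc _ ≤ _ := (enorm_add_le _ _).trans (add_le_add_left (enorm_sub_le) _)
    _ ≤ _ := add_le_add (add_le_add h1 h2) h3
    _ = _ := by ring

theorem lintegral_le_measure_univ_rpow_mul {α : Type*} [MeasurableSpace α] (μ : Measure α)
    {p : ℝ} (hp : 1 < p) {h : α → ℝ≥0∞} (hh : AEMeasurable h μ) :
    ∫⁻ a, h a ∂μ ≤ μ univ ^ (1 - 1 / p) * (∫⁻ a, h a ^ p ∂μ) ^ (1 / p) := by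
  have hpq : p.HolderConjugate p.conjExponent := Real.HolderConjugate.conjExponent hp
  have := ENNReal.lintegral_mul_le_Lp_mul_Lq μ hpq.symm aemeasurable_one hh
  simpa [hpq.one_sub_inv] using this

variable [MeasurableSpace E] [BorelSpace E] [FiniteDimensional ℝ E]
  (μ : Measure E) [μ.IsAddHaarMeasure]

theorem lintegral_comp_add_smul_sub {K : E → ℝ≥0∞} (hK : Measurable K) (y : E) {s : ℝ}
    (hs : 0 < s) :
    ∫⁻ b, K (y + s • (b - y)) ∂μ = ENNReal.ofReal ((s ^ Module.finrank ℝ E)⁻¹) * ∫⁻ w, K w ∂μ := by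
  have h0 : Measurable fun b : E => s • b := measurable_const_smul s
  have h1 : Measurable fun b : E => K (y + b) := hK.comp (measurable_const_add y)
  rw [lintegral_sub_right_eq_self (fun b => K (y + s • b)) y,
    ← lintegral_map (f := fun w => K (y + w)) h1 h0, Measure.map_addHaar_smul μ hs.ne',
    lintegral_smul_measure, lintegral_add_left_eq_self, abs_of_nonneg (by positivity), smul_eq_mul]

theorem setLIntegral_comp_add_smul_sub {K : E → ℝ≥0∞} (hK : Measurable K) (y z : E) {s : ℝ}
    (hs : 0 < s) (ρ : ℝ) :
    ∫⁻ b in ball z ρ, K (y + s • (b - y)) ∂μ = ENNReal.ofReal ((s ^ Module.finrank ℝ E)⁻¹) *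
      ∫⁻ w in ball (y + s • (z - y)) (s * ρ), K w ∂μ := by
  rw [← lintegral_indicator measurableSet_ball, ← lintegral_indicator measurableSet_ball,
    ← lintegral_comp_add_smul_sub μ (hK.indicator measurableSet_ball) y hs]
  refine lintegral_congr fun b => ?_
  have : y + s • (b - y) ∈ ball (y + s • (z - y)) (s * ρ) ↔ b ∈ ball z ρ := by
    rw [mem_ball, mem_ball, dist_add_left, dist_eq_norm, ← smul_sub, sub_sub_sub_cancel_right,
      norm_smul, Real.norm_of_nonneg hs.le, mul_lt_mul_iff_right₀ hs, dist_eq_norm]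
  by_cases hb : b ∈ ball z ρ
  · rw [indicator_of_mem hb, indicator_of_mem (this.2 hb)]
  · rw [indicator_of_notMem hb, indicator_of_notMem (mt this.1 hb)]

/-- Hölder reduces to the average of `H ^ p` composed with the homothety of centre `y` and ratio
`s`. Its image ball lies in a ball about `x`, and the Jacobian times the volume ratio is `(τ / s) ^
d`. -/
theorem setLIntegral_comp_le_maximalFunction {p : ℝ} (hp : 1 < p) {H : E → ℝ≥0∞}
    (hH : Measurable H) {x y z : E} {s ρ τ : ℝ} (hs : 0 < s) (hρ : 0 < ρ) (hτ : 0 < τ)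
    (hsub : ball (y + s • (z - y)) (s * ρ) ⊆ ball x (τ * ρ)) :
    ∫⁻ b in ball z ρ, H (y + s • (b - y)) ∂μ ≤
      μ (ball z ρ) * (ENNReal.ofReal ((τ / s) ^ Module.finrank ℝ E) ^ (1 / p) *
        maximalFunction μ (fun w => H w ^ p) x ^ (1 / p)) := by
  set d := Module.finrank ℝ E
  set V := μ (ball z ρ) with hV
  have hp0 : 0 < p := by linarith
  have hV0 : V ≠ 0 := (measure_ball_pos μ z hρ).ne'
  have hVt : V ≠ ⊤ := measure_ball_lt_top.ne
  have hm : Measurable fun b => H (y + s • (b - y)) :=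
    hH.comp (by fun_prop)
  refine (lintegral_le_measure_univ_rpow_mul _ hp hm.aemeasurable).trans ?_
  rw [Measure.restrict_apply_univ, ← hV,
    setLIntegral_comp_add_smul_sub μ (hH.pow_const p) y z hs ρ]
  have hx : x ∈ ball x (τ * ρ) := mem_ball_self (by positivity)
  have h1 : ∫⁻ w in ball (y + s • (z - y)) (s * ρ), H w ^ p ∂μ ≤
      ENNReal.ofReal (τ ^ d) * V * maximalFunction μ (fun w => H w ^ p) x := by
    refine (lintegral_mono_set hsub).trans ?_
    refine (setLIntegral_ball_le_maximalFunction μ _ hx).trans_eq ?_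
    rw [Measure.addHaar_ball_mul_of_pos μ x hτ, hV, Measure.addHaar_ball_center μ z]
  have h2 : ENNReal.ofReal ((s ^ d)⁻¹) * ∫⁻ w in ball (y + s • (z - y)) (s * ρ), H w ^ p ∂μ ≤
      V * (ENNReal.ofReal ((τ / s) ^ d) * maximalFunction μ (fun w => H w ^ p) x) := by
    refine (mul_le_mul_right h1 _).trans_eq ?_
    rw [div_pow, div_eq_inv_mul, ENNReal.ofReal_mul (by positivity)]
    ring
  calc _ ≤ V ^ (1 - 1 / p) * (V * (ENNReal.ofReal ((τ / s) ^ d) *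
        maximalFunction μ (fun w => H w ^ p) x)) ^ (1 / p) := by gcongr
    _ = V ^ (1 - 1 / p + 1 / p) * (ENNReal.ofReal ((τ / s) ^ d) *
        maximalFunction μ (fun w => H w ^ p) x) ^ (1 / p) := by
      rw [ENNReal.mul_rpow_of_nonneg _ _ (by positivity), ← mul_assoc,
        ENNReal.rpow_add _ _ hV0 hVt]
    _ = _ := by
      rw [ENNReal.mul_rpow_of_nonneg _ _ (by positivity), sub_add_cancel, ENNReal.rpow_one]

/-- The integrand is a multiple of `s ^ (1 - d / p)`, and `p > d / 2` makes the exponent larger than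
`-1`. -/
theorem lintegral_ofReal_mul_rpow_lt_top {p : ℝ} {d : ℕ} (hp : 1 < p) (hd : (d : ℝ) / 2 < p)
    {τ : ℝ} (hτ : 0 < τ) :
    ∫⁻ s in Ioc (0 : ℝ) 1, ENNReal.ofReal s * ENNReal.ofReal ((τ / s) ^ d) ^ (1 / p) < ⊤ := by
  have hp0 : 0 < p := by linarith
  have e : ∀ s ∈ Ioc (0 : ℝ) 1, ENNReal.ofReal s * ENNReal.ofReal ((τ / s) ^ d) ^ (1 / p) =
      ENNReal.ofReal (τ ^ (d / p) * s ^ (1 - d / p)) := by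
    intro s hs
    have hs0 : 0 < s := hs.1
    rw [ENNReal.ofReal_rpow_of_nonneg (by positivity) (by positivity),
      ← ENNReal.ofReal_mul hs0.le, ← Real.rpow_natCast, ← Real.rpow_mul (by positivity),
      Real.div_rpow hτ.le hs0.le, Real.rpow_sub hs0, Real.rpow_one]
    congr 1
    rw [mul_one_div]
    ring
  rw [setLIntegral_congr_fun measurableSet_Ioc e]
  have hint : IntegrableOn (fun s : ℝ => τ ^ (d / p) * s ^ (1 - d / p)) (Ioc 0 1) := by
    rw [← intervalIntegrable_iff_integrableOn_Ioc_of_le zero_le_one]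
    refine (intervalIntegral.intervalIntegrable_rpow' ?_).const_mul _
    have : d / p < 2 := by
      rw [div_lt_iff₀ hp0]
      linarith
    linarith
  rw [← ofReal_integral_eq_lintegral_ofReal hint]
  · exact ENNReal.ofReal_lt_top
  · filter_upwards [ae_restrict_mem measurableSet_Ioc] with s hs
    have := hs.1
    positivity

/-- If `x, y` see a common ball, the error of the first order Taylor expansion of `f` at `x` is
bounded by the maximal function of the second derivative. -/
theorem exists_enorm_sub_sub_fderiv_le_maximalFunction {p : ℝ} (hp : 1 < p)
    (hd : (Module.finrank ℝ E : ℝ) / 2 < p) {L : ℝ} (hL : 0 ≤ L) :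
    ∃ C : ℝ≥0, ∀ (f : E → ℝ) (H : E → ℝ≥0∞) (x y z : E), ContDiff ℝ 2 f → Measurable H →
      dist x z ≤ L * dist x y →
      (∀ b ∈ ball z (dist x y), ∀ w ∈ segment ℝ x b ∪ segment ℝ y b,
        ‖fderiv ℝ (fderiv ℝ f) w‖ₑ ≤ H w) →
      ‖f y - f x - fderiv ℝ f x (y - x)‖ₑ ≤
        C * ‖y - x‖ₑ ^ 2 * maximalFunction μ (fun w => H w ^ p) x ^ (1 / p) := by
  set d := Module.finrank ℝ E with hdd
  set τ := L + 4 with hτ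
  have hτ0 : 0 < τ := by positivity
  have hp0 : 0 < p := by linarith
  set C₁ := ∫⁻ s in Ioc (0 : ℝ) 1, ENNReal.ofReal s * ENNReal.ofReal ((τ / s) ^ d) ^ (1 / p)
    with hC₁
  have hC₁' : C₁ ≠ ⊤ := (lintegral_ofReal_mul_rpow_lt_top hp hd hτ0).ne
  set C₂ := ENNReal.ofReal (τ ^ d) ^ (1 / p) with hC₂
  have hC₂' : C₂ ≠ ⊤ := ENNReal.rpow_ne_top_of_nonneg (by positivity) (by simp)
  set C := (C₁ + 2 * C₂) * ENNReal.ofReal τ ^ 2 with hC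
  have hC' : C ≠ ⊤ := by finiteness
  refine ⟨C.toNNReal, fun f H x y z hf hH hz hfH => ?_⟩
  rw [ENNReal.coe_toNNReal hC']
  rcases eq_or_ne x y with rfl | hxy
  · simp
  set ρ := dist x y with hρ
  have hρ0 : 0 < ρ := dist_pos.2 hxy
  set A := maximalFunction μ (fun w => H w ^ p) x ^ (1 / p) with hA
  set V := μ (ball z ρ) with hV
  have hV0 : V ≠ 0 := (measure_ball_pos μ z hρ0).ne'
  have hVt : V ≠ ⊤ := measure_ball_lt_top.ne
  set m := ENNReal.ofReal τ * ‖y - x‖ₑ with hm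
  have hyx : ‖y - x‖ = ρ := by rw [hρ, dist_comm, dist_eq_norm]
  have hmle : ∀ v : E, ‖v‖ ≤ τ * ρ → ‖v‖ₑ ≤ m := by
    intro v hv
    rw [hm, ← ofReal_norm, ← ofReal_norm, ← ENNReal.ofReal_mul hτ0.le, hyx]
    exact ENNReal.ofReal_le_ofReal hv
  have hzx : ‖z - x‖ ≤ L * ρ := by rwa [dist_comm, dist_eq_norm] at hz
  have hmeas : ∀ v : E, Measurable fun q : E × ℝ => H (v + q.2 • (q.1 - v)) := fun v =>
    hH.comp (by fun_prop)
  have hpt : ∀ b ∈ ball z ρ, ‖f y - f x - fderiv ℝ f x (y - x)‖ₑ ≤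
      ((∫⁻ s in Ioc (0 : ℝ) 1, ENNReal.ofReal s * H (y + s • (b - y))) +
        2 * ∫⁻ s in Ioc (0 : ℝ) 1, H (x + s • (b - x))) * m ^ 2 := by
    intro b hb
    have hb' : ‖b - z‖ < ρ := by rwa [mem_ball, dist_eq_norm] at hb
    have hbx : ‖b - x‖ ≤ (L + 1) * ρ := by
      have := norm_sub_le_norm_sub_add_norm_sub b z x
      linarith
    refine enorm_sub_sub_fderiv_le hf ?_ ?_ (hmle _ ?_) (hmle _ ?_) (hmle _ ?_)
    · intro s hs
      refine hfH b hb _ (Or.inl ?_)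
      rw [segment_eq_image']
      exact ⟨s, hs, rfl⟩
    · intro s hs
      refine hfH b hb _ (Or.inr ?_)
      rw [segment_eq_image']
      exact ⟨s, hs, rfl⟩
    · rw [hτ]; linarith
    · have := norm_sub_le_norm_sub_add_norm_sub b x y
      rw [norm_sub_rev x y, hyx] at this
      rw [hτ]; linarith
    · rw [hyx, hτ]; nlinarith
  have hswap : ∀ (v : E) (w : ℝ → ℝ≥0∞), Measurable w →
      ∫⁻ b in ball z ρ, (∫⁻ s in Ioc (0 : ℝ) 1, w s * H (v + s • (b - v))) ∂μ =
      ∫⁻ s in Ioc (0 : ℝ) 1, w s * ∫⁻ b in ball z ρ, H (v + s • (b - v)) ∂μ := by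
    intro v w hw
    rw [lintegral_lintegral_swap ((hw.comp measurable_snd).mul (hmeas v)).aemeasurable]
    refine lintegral_congr fun s => ?_
    rw [lintegral_const_mul]
    exact hH.comp (by fun_prop)
  -- The balls swept from `y` shrink to `y`, not to `x`, so they are compared with one fixed ball
  -- about `x`; the loss is absorbed in `C₁`.
  have hI₁ : ∫⁻ b in ball z ρ, (∫⁻ s in Ioc (0 : ℝ) 1, ENNReal.ofReal s * H (y + s • (b - y))) ∂μ ≤
      V * (C₁ * A) := by
    rw [hswap y _ ENNReal.measurable_ofReal, hC₁, ← lintegral_mul_const _ (by fun_prop),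
      ← lintegral_const_mul _ (by fun_prop)]
    refine setLIntegral_mono' measurableSet_Ioc fun s hs => ?_
    refine (mul_le_mul_right (setLIntegral_comp_le_maximalFunction μ hp hH (x := x) (τ := τ)
      hs.1 hρ0 hτ0 ?_) _).trans_eq ?_
    · refine ball_subset_ball' ?_
      have h1 : dist (y + s • (z - y)) x ≤ ‖y - x‖ + s * (‖z - x‖ + ‖y - x‖) := by
        rw [dist_eq_norm]
        have : y + s • (z - y) - x = (y - x) + s • ((z - x) - (y - x)) := by module
        rw [this]
        refine (norm_add_le _ _).trans ?_
        rw [norm_smul, Real.norm_of_nonneg hs.1.le]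
        have := hs.1
        gcongr
        exact norm_sub_le _ _
      have h2 : s * (‖z - x‖ + ‖y - x‖) ≤ ‖z - x‖ + ‖y - x‖ :=
        mul_le_of_le_one_left (by positivity) hs.2
      have h3 : s * ρ ≤ ρ := mul_le_of_le_one_left hρ0.le hs.2
      rw [hyx] at h1 h2
      rw [hτ]
      linarith
    · rw [← hA, ← hV]
      ring
  have hI₂ : ∫⁻ b in ball z ρ, (∫⁻ s in Ioc (0 : ℝ) 1, H (x + s • (b - x))) ∂μ ≤
      V * (C₂ * A) := by
    have := hswap x 1 measurable_one
    simp only [Pi.one_apply, one_mul] at this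
    rw [this]
    calc _ ≤ ∫⁻ s in Ioc (0 : ℝ) 1, V * (C₂ * A) := by
          refine setLIntegral_mono' measurableSet_Ioc fun s hs => ?_
          have hs0 : 0 < s := hs.1
          -- The balls swept from `x` shrink to `x`, so the comparison radius scales with `s` and
          -- the ratio of volumes does not depend on `s`.
          refine (setLIntegral_comp_le_maximalFunction μ hp hH (x := x) (τ := s * τ)
            hs0 hρ0 (by positivity) ?_).trans_eq ?_
          · refine ball_subset_ball' ?_
            rw [dist_self_add_left, norm_smul, Real.norm_of_nonneg hs0.le, hτ]
            have : s * ‖z - x‖ ≤ s * (L * ρ) := by gcongr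
            nlinarith [mul_pos hs0 hρ0]
          · rw [mul_div_cancel_left₀ _ hs0.ne']
      _ = _ := by simp
  -- The Taylor error does not depend on `b`: integrating over the ball multiplies it by `V`, which
  -- then cancels.
  have key : V * ‖f y - f x - fderiv ℝ f x (y - x)‖ₑ ≤
      V * (C * ‖y - x‖ₑ ^ 2 * A) := by
    calc V * ‖f y - f x - fderiv ℝ f x (y - x)‖ₑ
        = ∫⁻ _ in ball z ρ, ‖f y - f x - fderiv ℝ f x (y - x)‖ₑ ∂μ := by
          rw [setLIntegral_const, mul_comm]
      _ ≤ ∫⁻ b in ball z ρ, ((∫⁻ s in Ioc (0 : ℝ) 1, ENNReal.ofReal s * H (y + s • (b - y))) +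
          2 * ∫⁻ s in Ioc (0 : ℝ) 1, H (x + s • (b - x))) * m ^ 2 ∂μ :=
          setLIntegral_mono' measurableSet_ball hpt
      _ = ((∫⁻ b in ball z ρ,
            (∫⁻ s in Ioc (0 : ℝ) 1, ENNReal.ofReal s * H (y + s • (b - y))) ∂μ) +
          2 * ∫⁻ b in ball z ρ, (∫⁻ s in Ioc (0 : ℝ) 1, H (x + s • (b - x))) ∂μ) * m ^ 2 := by
          have hm2 : Measurable fun b : E => ∫⁻ s in Ioc (0 : ℝ) 1, H (x + s • (b - x)) :=
            (hmeas x).lintegral_prod_right'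
          rw [lintegral_mul_const' _ _ (by finiteness), lintegral_add_right _ (hm2.const_mul 2),
            lintegral_const_mul _ hm2]
      _ ≤ (V * (C₁ * A) + 2 * (V * (C₂ * A))) * m ^ 2 := by gcongr
      _ = _ := by rw [hC, hm]; ring
  exact (ENNReal.mul_le_mul_iff_right hV0 hVt).1 key

end Taylor

/-! ### Mollification of weakly differentiable functions -/

section Mollify

theorem fderiv_convolution_apply {E : Type*} [NormedAddCommGroup E] [NormedSpace ℝ E]
    [FiniteDimensional ℝ E] [MeasurableSpace E] [BorelSpace E] (μ : Measure E)
    [μ.IsAddHaarMeasure] {ψ U : E → ℝ} (hψ : HasCompactSupport ψ)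
    (hψc : ContDiff ℝ 1 ψ) (hU : LocallyIntegrable U μ) (x v : E) :
    fderiv ℝ (ψ ⋆[ContinuousLinearMap.lsmul ℝ ℝ, μ] U) x v =
      ((fun t => fderiv ℝ ψ t v) ⋆[ContinuousLinearMap.lsmul ℝ ℝ, μ] U) x := by
  have h := (hψ.hasFDerivAt_convolution_left (ContinuousLinearMap.lsmul ℝ ℝ) hψc hU x).fderiv
  have hex := (hψ.fderiv ℝ).convolutionExists_left
    ((ContinuousLinearMap.lsmul ℝ ℝ : ℝ →L[ℝ] ℝ →L[ℝ] ℝ).precompL E)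
    (hψc.continuous_fderiv (by norm_num)) hU x
  rw [h, convolution_def, convolution_def, ContinuousLinearMap.integral_apply hex]
  rfl

variable {n : ℕ} {Ω : Opens (EuclideanSpace ℝ (Fin n))}

local notation "𝔼" => EuclideanSpace ℝ (Fin n)

/-- The weak derivative tested against the reflected translates of a kernel. -/
theorem HasWeakDeriv.integral_kernel {k : ℕ} {I : Fin k → Fin n} {u g : 𝔼 → ℝ}
    (h : HasWeakDeriv Ω I u g) {ψ : 𝔼 → ℝ} (hψ : ContDiff ℝ (⊤ : ℕ∞) ψ) {R : ℝ}
    (hR : Function.support ψ ⊆ closedBall 0 R) {x : 𝔼} (hx : closedBall x R ⊆ Ω) :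
    ∫ y in Ω, u y * partialDeriv I (fun y => ψ (x - y)) y =
      (-1) ^ k * ∫ y in Ω, g y * ψ (x - y) := by
  have hsupp : tsupport (fun y => ψ (x - y)) ⊆ closedBall x R := by
    refine closure_minimal (fun y hy => ?_) isClosed_closedBall
    have := hR (a := x - y) hy
    rwa [mem_closedBall, dist_zero_right, ← dist_eq_norm, dist_comm] at this
  exact h.2.2 ⟨fun y => ψ (x - y), hψ.comp (contDiff_const.sub contDiff_id),
    (isCompact_closedBall x R).of_isClosed_subset (isClosed_tsupport _) hsupp, hsupp.trans hx⟩

theorem convolution_indicator_eq (ψ u : 𝔼 → ℝ) (x : 𝔼) :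
    (ψ ⋆[ContinuousLinearMap.lsmul ℝ ℝ, volume] (Ω : Set 𝔼).indicator u) x =
      ∫ y in Ω, u y * ψ (x - y) := by
  rw [convolution_lsmul_swap, ← integral_indicator Ω.isOpen.measurableSet]
  congr 1 with y
  by_cases hy : y ∈ (Ω : Set 𝔼)
  · simp only [indicator_of_mem hy, smul_eq_mul, mul_comm]
  · simp only [indicator_of_notMem hy, smul_eq_mul, mul_zero]

theorem fderiv_comp_const_sub_apply {ψ : 𝔼 → ℝ} (hψ : Differentiable ℝ ψ) (x y v : 𝔼) :
    fderiv ℝ (fun y => ψ (x - y)) y v = -fderiv ℝ ψ (x - y) v := by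
  have h : HasFDerivAt (fun y : 𝔼 => x - y) (-ContinuousLinearMap.id ℝ 𝔼) y :=
    (hasFDerivAt_id y).const_sub x
  have h' : HasFDerivAt (fun y => ψ (x - y)) _ y := (hψ (x - y)).hasFDerivAt.comp y h
  rw [h'.fderiv]
  simp

theorem fderiv_fderiv_apply {ψ : 𝔼 → ℝ} (hψ : ContDiff ℝ 2 ψ) (x v w : 𝔼) :
    fderiv ℝ (fderiv ℝ ψ) x v w = fderiv ℝ (fun t => fderiv ℝ ψ t w) x v := by
  have h1 : ContDiff ℝ 1 (fderiv ℝ ψ) := hψ.fderiv_right (by norm_num)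
  have h2 : HasFDerivAt (fun t => fderiv ℝ ψ t w) _ x :=
    (ContinuousLinearMap.apply ℝ ℝ w).hasFDerivAt.comp x
      (h1.differentiable (by norm_num) x).hasFDerivAt
  rw [h2.fderiv]
  rfl

theorem partialDeriv_one_kernel {ψ : 𝔼 → ℝ} (hψ : ContDiff ℝ 2 ψ) (i : Fin n) (x y : 𝔼) :
    partialDeriv ![i] (fun y => ψ (x - y)) y =
      -fderiv ℝ ψ (x - y) (EuclideanSpace.single i (1 : ℝ)) := by
  rw [partialDeriv, iteratedFDeriv_one_apply]
  exact fderiv_comp_const_sub_apply (hψ.differentiable (by norm_num)) x y _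

theorem partialDeriv_two_kernel {ψ : 𝔼 → ℝ} (hψ : ContDiff ℝ 2 ψ) (i j : Fin n) (x y : 𝔼) :
    partialDeriv ![i, j] (fun y => ψ (x - y)) y =
      fderiv ℝ (fun t => fderiv ℝ ψ t (EuclideanSpace.single j (1 : ℝ))) (x - y)
        (EuclideanSpace.single i (1 : ℝ)) := by
  have h1 : ContDiff ℝ 1 (fderiv ℝ ψ) := hψ.fderiv_right (by norm_num)
  have h0 : ContDiff ℝ 2 fun y => ψ (x - y) := hψ.comp (contDiff_const.sub contDiff_id)
  rw [partialDeriv, iteratedFDeriv_two_apply, fderiv_fderiv_apply h0]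
  have e : (fun t => fderiv ℝ (fun y => ψ (x - y)) t (EuclideanSpace.single j (1 : ℝ))) =
      fun t => -(fun t => fderiv ℝ ψ t (EuclideanSpace.single j (1 : ℝ))) (x - t) := by
    ext t
    exact fderiv_comp_const_sub_apply (hψ.differentiable (by norm_num)) x t _
  have h2 : Differentiable ℝ fun t => fderiv ℝ ψ t (EuclideanSpace.single j (1 : ℝ)) :=
    (h1.differentiable (by norm_num)).clm_apply (differentiable_const _)
  change fderiv ℝ (fun t => fderiv ℝ (fun y => ψ (x - y)) t (EuclideanSpace.single j (1 : ℝ))) y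
    (EuclideanSpace.single i (1 : ℝ)) = _
  rw [e, fderiv_fun_neg, neg_apply, fderiv_comp_const_sub_apply h2, neg_neg]

/-- The derivative falls on the kernel, and `ψ (x - ·)` is an admissible test function because
`closedBall x R ⊆ Ω`; hence extending `u` by zero does no harm at such `x`. The sign from reflecting
the kernel cancels the one in the weak derivative. -/
theorem HasWeakDeriv.fderiv_convolution {u g ψ : 𝔼 → ℝ} {R : ℝ} {x : 𝔼}
    {i : Fin n} (h : HasWeakDeriv Ω ![i] u g)
    (hu : IntegrableOn u Ω) (hψ : ContDiff ℝ (⊤ : ℕ∞) ψ)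
    (hR : Function.support ψ ⊆ closedBall 0 R) (hx : closedBall x R ⊆ Ω) :
    fderiv ℝ (ψ ⋆[ContinuousLinearMap.lsmul ℝ ℝ, volume] (Ω : Set 𝔼).indicator u) x
      (EuclideanSpace.single i (1 : ℝ)) =
      (ψ ⋆[ContinuousLinearMap.lsmul ℝ ℝ, volume] (Ω : Set 𝔼).indicator g) x := by
  have hψ2 : ContDiff ℝ 2 ψ := by exact_mod_cast contDiff_infty.1 hψ 2
  have hc : HasCompactSupport ψ :=
    HasCompactSupport.of_support_subset_isCompact (isCompact_closedBall 0 R) hR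
  have hU : LocallyIntegrable ((Ω : Set 𝔼).indicator u) :=
    ((integrable_indicator_iff Ω.isOpen.measurableSet).2 hu).locallyIntegrable
  rw [fderiv_convolution_apply _ hc (hψ2.of_le (by norm_num)) hU, convolution_indicator_eq,
    convolution_indicator_eq]
  have := h.integral_kernel hψ hR hx
  simp_rw [partialDeriv_one_kernel hψ2] at this
  simpa [integral_neg] using this

theorem HasWeakDeriv.fderiv_fderiv_convolution {u g ψ : 𝔼 → ℝ} {R : ℝ} {x : 𝔼}
    {i j : Fin n} (h : HasWeakDeriv Ω ![i, j] u g)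
    (hu : IntegrableOn u Ω) (hψ : ContDiff ℝ (⊤ : ℕ∞) ψ)
    (hR : Function.support ψ ⊆ closedBall 0 R) (hx : closedBall x R ⊆ Ω) :
    fderiv ℝ (fderiv ℝ (ψ ⋆[ContinuousLinearMap.lsmul ℝ ℝ, volume] (Ω : Set 𝔼).indicator u)) x
      (EuclideanSpace.single i (1 : ℝ)) (EuclideanSpace.single j (1 : ℝ)) =
      (ψ ⋆[ContinuousLinearMap.lsmul ℝ ℝ, volume] (Ω : Set 𝔼).indicator g) x := by
  have hψ2 : ContDiff ℝ 2 ψ := by exact_mod_cast contDiff_infty.1 hψ 2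
  have hc : HasCompactSupport ψ :=
    HasCompactSupport.of_support_subset_isCompact (isCompact_closedBall 0 R) hR
  have hU : LocallyIntegrable ((Ω : Set 𝔼).indicator u) :=
    ((integrable_indicator_iff Ω.isOpen.measurableSet).2 hu).locallyIntegrable
  have hf : ContDiff ℝ 2 (ψ ⋆[ContinuousLinearMap.lsmul ℝ ℝ, volume] (Ω : Set 𝔼).indicator u) :=
    HasCompactSupport.contDiff_convolution_left (n := 2) _ hc hψ2 hU
  have h1 : ContDiff ℝ 1 (fderiv ℝ ψ) := hψ2.fderiv_right (by norm_num)
  have hc1 : HasCompactSupport fun t => fderiv ℝ ψ t (EuclideanSpace.single j (1 : ℝ)) :=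
    hc.fderiv_apply ℝ _
  have hd1 : ContDiff ℝ 1 fun t => fderiv ℝ ψ t (EuclideanSpace.single j (1 : ℝ)) :=
    h1.clm_apply contDiff_const
  have e : (fun t => fderiv ℝ (ψ ⋆[ContinuousLinearMap.lsmul ℝ ℝ, volume]
      (Ω : Set 𝔼).indicator u) t (EuclideanSpace.single j (1 : ℝ))) =
      (fun t => fderiv ℝ ψ t (EuclideanSpace.single j (1 : ℝ)))
        ⋆[ContinuousLinearMap.lsmul ℝ ℝ, volume] (Ω : Set 𝔼).indicator u := by
    ext t
    exact fderiv_convolution_apply _ hc (hψ2.of_le (by norm_num)) hU _ _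
  rw [fderiv_fderiv_apply hf, e, fderiv_convolution_apply _ hc1 hd1 hU, convolution_indicator_eq,
    convolution_indicator_eq]
  have := h.integral_kernel hψ hR hx
  simp_rw [partialDeriv_two_kernel hψ2] at this
  simpa using this

/-- Mollifications are bounded by the maximal function. -/
theorem enorm_convolution_normed_le (φ : ContDiffBump (0 : 𝔼)) (hφ : φ.rOut ≤ 2 * φ.rIn)
    (G : 𝔼 → ℝ) (x : 𝔼) :
    ‖(φ.normed volume ⋆[ContinuousLinearMap.lsmul ℝ ℝ, volume] G) x‖ₑ ≤
      ENNReal.ofReal (2 ^ n) * maximalFunction volume (fun y => ‖G y‖ₑ) x := by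
  set V : ℝ≥0∞ := volume (ball x φ.rOut) with hV
  have hV0 : V ≠ 0 := (measure_ball_pos volume x φ.rOut_pos).ne'
  have hVt : V ≠ ⊤ := measure_ball_lt_top.ne
  have hVc : volume.real (closedBall (0 : 𝔼) φ.rOut) = V.toReal := by
    rw [hV, Measure.real, Measure.addHaar_closedBall _ _ φ.rOut_pos.le,
      Measure.addHaar_ball_of_pos _ _ φ.rOut_pos]
  -- The bump equals 1 on a ball of at least half the outer radius, so normalization costs at most
  -- `2 ^ n` over the mean on the outer ball.
  have hle : ∀ t, ‖φ.normed volume t‖ₑ ≤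
      (ball (0 : 𝔼) φ.rOut).indicator (fun _ => ENNReal.ofReal (2 ^ n) * V⁻¹) t := by
    intro t
    by_cases ht : t ∈ ball (0 : 𝔼) φ.rOut
    · rw [indicator_of_mem ht, Real.enorm_of_nonneg (φ.nonneg_normed t)]
      have h1 := φ.normed_le_div_measure_closedBall_rOut volume 2 hφ t
      rw [hVc, finrank_euclideanSpace_fin] at h1
      refine (ENNReal.ofReal_le_ofReal h1).trans_eq ?_
      rw [ENNReal.ofReal_div_of_pos (ENNReal.toReal_pos hV0 hVt), ENNReal.ofReal_toReal hVt,
        div_eq_mul_inv]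
    · have : φ.normed volume t = 0 := by
        by_contra h
        exact ht (φ.support_normed_eq (μ := volume) ▸ h)
      simp [this]
  rw [convolution_lsmul_swap]
  calc _ ≤ ∫⁻ t, ‖φ.normed volume (x - t) • G t‖ₑ := enorm_integral_le_lintegral_enorm _
    _ ≤ ∫⁻ t, (ball x φ.rOut).indicator
        (fun t => ENNReal.ofReal (2 ^ n) * V⁻¹ * ‖G t‖ₑ) t := by
      refine lintegral_mono fun t => ?_
      rw [enorm_smul]
      have hmem : x - t ∈ ball (0 : 𝔼) φ.rOut ↔ t ∈ ball x φ.rOut := by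
        rw [mem_ball, mem_ball, dist_zero_right, ← dist_eq_norm, dist_comm]
      refine (mul_le_mul_left (hle (x - t)) _).trans ?_
      by_cases ht : t ∈ ball x φ.rOut
      · rw [indicator_of_mem ht, indicator_of_mem (hmem.2 ht)]
      · rw [indicator_of_notMem ht, indicator_of_notMem (mt hmem.1 ht), zero_mul]
    _ = ENNReal.ofReal (2 ^ n) * (V⁻¹ * ∫⁻ t in ball x φ.rOut, ‖G t‖ₑ) := by
      rw [lintegral_indicator measurableSet_ball, lintegral_const_mul', mul_assoc]
      exact ENNReal.mul_ne_top (by simp) (ENNReal.inv_ne_top.2 hV0)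
    _ ≤ _ := by
      gcongr
      exact average_le_maximalFunction _ _ (mem_ball_self φ.rOut_pos)

theorem opENorm_le_sum (T : 𝔼 →L[ℝ] 𝔼 →L[ℝ] ℝ) :
    ‖T‖ₑ ≤ ∑ i, ∑ j, ‖T (EuclideanSpace.single i (1 : ℝ)) (EuclideanSpace.single j (1 : ℝ))‖ₑ := by
  have hexp : ∀ v : 𝔼, v = ∑ i, v i • EuclideanSpace.single i (1 : ℝ) := fun v => by
    ext k
    simp [Pi.single_apply]
  have hnn : ‖T‖ ≤ ∑ i, ∑ j,
      ‖T (EuclideanSpace.single i (1 : ℝ)) (EuclideanSpace.single j (1 : ℝ))‖ := by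
    refine T.opNorm_le_bound₂ (by positivity) fun v w => ?_
    have e : T v w = ∑ i, ∑ j, v i * w j *
        T (EuclideanSpace.single i (1 : ℝ)) (EuclideanSpace.single j (1 : ℝ)) := by
      conv_lhs => rw [hexp v, hexp w]
      simp only [map_sum, sum_apply, map_smul, smul_apply,
        smul_eq_mul, Finset.mul_sum]
      rw [Finset.sum_comm]
      refine Finset.sum_congr rfl fun i _ => Finset.sum_congr rfl fun j _ => by ring
    rw [e, Finset.sum_mul, Finset.sum_mul]
    refine (norm_sum_le _ _).trans (Finset.sum_le_sum fun i _ => ?_)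
    rw [Finset.sum_mul, Finset.sum_mul]
    refine (norm_sum_le _ _).trans (Finset.sum_le_sum fun j _ => ?_)
    rw [norm_mul, norm_mul, mul_comm, mul_assoc]
    gcongr
    · exact PiLp.norm_apply_le v i
    · exact PiLp.norm_apply_le w j
  refine (ofReal_norm T).symm.trans_le ((ENNReal.ofReal_le_ofReal hnn).trans_eq ?_)
  rw [ENNReal.ofReal_sum_of_nonneg fun i _ => by positivity]
  refine Finset.sum_congr rfl fun i _ => ?_
  rw [ENNReal.ofReal_sum_of_nonneg fun i _ => by positivity]
  exact Finset.sum_congr rfl fun j _ => ofReal_norm _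

end Mollify

/-! ### First order Taylor expansions of Sobolev functions -/

section SobolevTaylor

theorem maximalFunction_congr_ae {E : Type*} [NormedAddCommGroup E] [MeasurableSpace E]
    {μ : Measure E} {F G : E → ℝ≥0∞} (h : F =ᵐ[μ] G) :
    maximalFunction μ F = maximalFunction μ G := by
  have : ∀ s : Set E, ∫⁻ y in s, F y ∂μ = ∫⁻ y in s, G y ∂μ := fun s =>
    lintegral_congr_ae (ae_restrict_of_ae h)
  ext x
  simp only [maximalFunction, this]

theorem maximalFunction_const_mul {E : Type*} [NormedAddCommGroup E] [MeasurableSpace E]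
    (μ : Measure E) {c : ℝ≥0∞} (hc : c ≠ ⊤) (F : E → ℝ≥0∞) (x : E) :
    maximalFunction μ (fun y => c * F y) x = c * maximalFunction μ F x := by
  simp only [maximalFunction, ENNReal.mul_iSup]
  refine iSup_congr fun a => iSup_congr fun r => ?_
  by_cases hx : x ∈ ball a r
  · rw [indicator_of_mem hx, indicator_of_mem hx, lintegral_const_mul' _ _ hc]
    ring
  · rw [indicator_of_notMem hx, indicator_of_notMem hx, mul_zero]

/-- The maximal function of exponent `p` of the maximal function. -/
noncomputable def iteratedMaximal {E : Type*} [NormedAddCommGroup E] [MeasurableSpace E]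
    (μ : Measure E) (p : ℝ) (F : E → ℝ≥0∞) (x : E) : ℝ≥0∞ :=
  maximalFunction μ (fun w => maximalFunction μ F w ^ p) x ^ (1 / p)

theorem measurable_iteratedMaximal {E : Type*} [NormedAddCommGroup E] [MeasurableSpace E]
    [BorelSpace E] (μ : Measure E) (p : ℝ) (F : E → ℝ≥0∞) :
    Measurable (iteratedMaximal μ p F) :=
  (measurable_maximalFunction μ _).pow_const _

/-- The strong type bound is applied twice, with exponent `q / p` for the outer maximal function and
`q` for the inner one; both exceed 1. -/
theorem exists_lintegral_iteratedMaximal_rpow_le {E : Type*} [NormedAddCommGroup E]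
    [MeasurableSpace E] [NormedSpace ℝ E] [FiniteDimensional ℝ E] [BorelSpace E] [Nontrivial E]
    (μ : Measure E) [μ.IsAddHaarMeasure] {p q : ℝ} (hp : 1 < p) (hpq : p < q) :
    ∃ C : ℝ≥0, ∀ F : E → ℝ≥0∞, AEMeasurable F μ →
      ∫⁻ x, iteratedMaximal μ p F x ^ q ∂μ ≤ C * ∫⁻ x, F x ^ q ∂μ := by
  have hp0 : 0 < p := by linarith
  obtain ⟨C₁, hC₁⟩ := exists_lintegral_maximalFunction_rpow_le μ (hp.trans hpq)
  obtain ⟨C₂, hC₂⟩ := exists_lintegral_maximalFunction_rpow_le μ ((one_lt_div hp0).2 hpq)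
  refine ⟨C₂ * C₁, fun F hF => ?_⟩
  have h1 := hC₁ _ hF.measurable_mk
  rw [maximalFunction_congr_ae hF.ae_eq_mk.symm] at h1
  have h2 := hC₂ _ ((measurable_maximalFunction μ F).pow_const p)
  have e1 : ∫⁻ x, hF.mk F x ^ q ∂μ = ∫⁻ x, F x ^ q ∂μ :=
    lintegral_congr_ae (hF.ae_eq_mk.symm.fun_comp (· ^ q))
  calc _ = ∫⁻ x, maximalFunction μ (fun w => maximalFunction μ F w ^ p) x ^ (q / p) ∂μ := by
        simp only [iteratedMaximal, ← ENNReal.rpow_mul]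
        congr! 3
        ring
    _ ≤ C₂ * ∫⁻ x, (maximalFunction μ F x ^ p) ^ (q / p) ∂μ := h2
    _ = C₂ * ∫⁻ x, maximalFunction μ F x ^ q ∂μ := by
        simp only [← ENNReal.rpow_mul, mul_div_cancel₀ _ hp0.ne']
    _ ≤ C₂ * (C₁ * ∫⁻ x, F x ^ q ∂μ) := by
        rw [← e1]
        gcongr
    _ = _ := by rw [← mul_assoc, ENNReal.coe_mul]

variable {n : ℕ}

/-- The standard mollifiers. -/
noncomputable def mollifier (E : Type*) [NormedAddCommGroup E] (k : ℕ) : ContDiffBump (0 : E) where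
  rIn := 1 / (2 * (k + 1))
  rOut := 1 / (k + 1)
  rIn_pos := by positivity
  rIn_lt_rOut := by
    have : (0 : ℝ) < k + 1 := by positivity
    rw [div_lt_div_iff₀ (by positivity) this]
    linarith

/-- The sum of the sizes of the second derivatives, extended by zero. -/
noncomputable def hessianSize (Ω : Set (EuclideanSpace ℝ (Fin n)))
    (h : Fin n → Fin n → EuclideanSpace ℝ (Fin n) → ℝ) (x : EuclideanSpace ℝ (Fin n)) : ℝ≥0∞ :=
  ∑ i, ∑ j, ‖Ω.indicator (h i j) x‖ₑ

/-- Compactness leaves room between the segments used in Taylor's formula and the complement of `Ω`,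
so fine mollifiers see only `Ω`. -/
theorem isCompact_iUnion_segment {E : Type*} [NormedAddCommGroup E] [NormedSpace ℝ E]
    (x : E) {S : Set E} (hS : IsCompact S) : IsCompact (⋃ b ∈ S, segment ℝ x b) := by
  have : (⋃ b ∈ S, segment ℝ x b) =
      (fun q : E × ℝ => x + q.2 • (q.1 - x)) '' (S ×ˢ Icc (0 : ℝ) 1) := by
    ext w
    simp only [mem_iUnion, segment_eq_image', mem_image, mem_prod, Prod.exists, exists_prop]
    constructor
    · rintro ⟨b, hb, s, hs, rfl⟩
      exact ⟨b, s, ⟨hb, hs⟩, rfl⟩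
    · rintro ⟨b, s, ⟨hb, hs⟩, rfl⟩
      exact ⟨b, hb, s, hs, rfl⟩
  rw [this]
  exact (hS.prod isCompact_Icc).image (by fun_prop)

/-- Outside a null set, the first order Taylor expansion of a function with second order weak
derivatives has a quadratic error controlled by the maximal function. -/
theorem IsBoundedC11Domain.exists_taylor {Ω : Opens (EuclideanSpace ℝ (Fin n))}
    (hΩ : IsBoundedC11Domain (Ω : Set (EuclideanSpace ℝ (Fin n)))) {p : ℝ} (hp : 1 < p)
    (hnp : (n : ℝ) / 2 < p) :
    ∃ r₀ > 0, ∃ C : ℝ≥0, ∀ (u : EuclideanSpace ℝ (Fin n) → ℝ)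
      (g : Fin n → EuclideanSpace ℝ (Fin n) → ℝ)
      (h : Fin n → Fin n → EuclideanSpace ℝ (Fin n) → ℝ), IntegrableOn u Ω →
      (∀ i, HasWeakDeriv Ω ![i] u (g i)) → (∀ i, IntegrableOn (g i) Ω) →
      (∀ i j, HasWeakDeriv Ω ![i, j] u (h i j)) →
      ∃ G ⊆ (Ω : Set (EuclideanSpace ℝ (Fin n))), (∀ᵐ x ∂volume.restrict Ω, x ∈ G) ∧
        ∀ x ∈ G, ∀ y ∈ G, dist x y < r₀ →
          ‖u y - u x - ∑ i, (y i - x i) * g i x‖ₑ ≤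
            C * ‖y - x‖ₑ ^ 2 * iteratedMaximal volume p (hessianSize Ω h) x := by
  have hp0 : 0 < p := by linarith
  obtain ⟨r₀, hr₀, L, hL, hgeo⟩ := hΩ.exists_common_ball
  obtain ⟨C, hC⟩ := exists_enorm_sub_sub_fderiv_le_maximalFunction
    (volume : Measure (EuclideanSpace ℝ (Fin n))) hp (by simpa using hnp) hL
  -- A factor `2 ^ n` for each mollified entry, and `n ^ 2` entries in the Hessian.
  set c : ℝ≥0∞ := ENNReal.ofReal (2 ^ n) * (n ^ 2 : ℕ) with hc
  have hc' : c ≠ ⊤ := by finiteness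
  refine ⟨r₀, hr₀, C * c.toNNReal, fun u g h hu hg hgi hh => ?_⟩
  set U := (Ω : Set (EuclideanSpace ℝ (Fin n))).indicator u with hU
  have hUl : ∀ w : EuclideanSpace ℝ (Fin n) → ℝ, IntegrableOn w Ω →
      LocallyIntegrable ((Ω : Set (EuclideanSpace ℝ (Fin n))).indicator w) := fun w hw =>
    ((integrable_indicator_iff Ω.isOpen.measurableSet).2 hw).locallyIntegrable
  set φ := mollifier (EuclideanSpace ℝ (Fin n)) with hφ
  have hφ2 : ∀ k, (φ k).rOut ≤ 2 * (φ k).rIn := fun k => by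
    change 1 / ((k : ℝ) + 1) ≤ 2 * (1 / (2 * (k + 1)))
    apply le_of_eq
    field_simp
  have hφ0 : Tendsto (fun k => (φ k).rOut) atTop (𝓝 0) := tendsto_one_div_add_atTop_nhds_zero_nat
  have hconv : ∀ w : EuclideanSpace ℝ (Fin n) → ℝ, IntegrableOn w Ω →
      ∀ᵐ x ∂volume.restrict Ω, Tendsto (fun k => ((φ k).normed volume
        ⋆[ContinuousLinearMap.lsmul ℝ ℝ, volume]
          (Ω : Set (EuclideanSpace ℝ (Fin n))).indicator w) x) atTop (𝓝 (w x)) := by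
    intro w hw
    filter_upwards [ae_restrict_of_ae
      (ContDiffBump.ae_convolution_tendsto_right_of_locallyIntegrable hφ0
        (Eventually.of_forall hφ2) (hUl w hw)), ae_restrict_mem Ω.isOpen.measurableSet]
      with x hx hxΩ
    rwa [indicator_of_mem hxΩ] at hx
  set f : ℕ → EuclideanSpace ℝ (Fin n) → ℝ := fun k =>
    (φ k).normed volume ⋆[ContinuousLinearMap.lsmul ℝ ℝ, volume] U with hf
  set gk : ℕ → Fin n → EuclideanSpace ℝ (Fin n) → ℝ := fun k i =>
    (φ k).normed volume ⋆[ContinuousLinearMap.lsmul ℝ ℝ, volume]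
      (Ω : Set (EuclideanSpace ℝ (Fin n))).indicator (g i) with hgk
  -- `G` consists of the points where the mollifications of `u` and of its weak gradient converge to
  -- the chosen values. Hessians need not converge: they are only bounded, uniformly in the
  -- mollifier.
  refine ⟨{x | x ∈ Ω ∧ Tendsto (fun k => f k x) atTop (𝓝 (u x)) ∧
    ∀ i, Tendsto (fun k => gk k i x) atTop (𝓝 (g i x))}, fun x hx => hx.1, ?_, ?_⟩
  · filter_upwards [ae_restrict_mem Ω.isOpen.measurableSet, hconv u hu,
      ae_all_iff.2 fun i => hconv (g i) (hgi i)] with x h1 h2 h3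
    exact ⟨h1, h2, h3⟩
  rintro x ⟨hxΩ, hxu, hxg⟩ y ⟨hyΩ, hyu, -⟩ hxy
  obtain ⟨z, hz, hseg⟩ := hgeo x hxΩ y hyΩ hxy
  set S := closedBall z (dist x y) with hS
  have hScomp : IsCompact S := isCompact_closedBall _ _
  set K := (⋃ b ∈ S, segment ℝ x b) ∪ ⋃ b ∈ S, segment ℝ y b with hK
  have hKcomp : IsCompact K := (isCompact_iUnion_segment x hScomp).union
    (isCompact_iUnion_segment y hScomp)
  have hKΩ : K ⊆ Ω := union_subset (iUnion₂_subset fun b hb => (hseg b hb).1)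
    (iUnion₂_subset fun b hb => (hseg b hb).2)
  obtain ⟨δ, hδ, hδK⟩ := hKcomp.exists_cthickening_subset_open Ω.isOpen hKΩ
  have hxK : x ∈ K := Or.inl (mem_biUnion (mem_closedBall_self dist_nonneg)
    (left_mem_segment ℝ x z))
  have hlin : ∀ k, fderiv ℝ (f k) x (y - x) =
      ∑ i, (y i - x i) * fderiv ℝ (f k) x (EuclideanSpace.single i (1 : ℝ)) := by
    intro k
    have : y - x = ∑ i, (y i - x i) • EuclideanSpace.single i (1 : ℝ) := by
      ext j
      simp [Pi.single_apply]
    conv_lhs => rw [this]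
    simp only [map_sum, map_smul, smul_eq_mul]
  have hM : ∀ i j w, maximalFunction volume (fun v =>
      ‖(Ω : Set (EuclideanSpace ℝ (Fin n))).indicator (h i j) v‖ₑ) w ≤
      maximalFunction volume (hessianSize Ω h) w := fun i j w =>
    maximalFunction_mono _ (fun v => (Finset.single_le_sum (f := fun j =>
      ‖(Ω : Set (EuclideanSpace ℝ (Fin n))).indicator (h i j) v‖ₑ) (fun _ _ => zero_le)
      (Finset.mem_univ j)).trans (Finset.single_le_sum (f := fun i => ∑ j,
      ‖(Ω : Set (EuclideanSpace ℝ (Fin n))).indicator (h i j) v‖ₑ) (fun _ _ => zero_le)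
      (Finset.mem_univ i))) w
  have hbound : ∀ᶠ k in atTop, ‖f k y - f k x - ∑ i, (y i - x i) * gk k i x‖ₑ ≤
      ↑(C * c.toNNReal) * ‖y - x‖ₑ ^ 2 * iteratedMaximal volume p (hessianSize Ω h) x := by
    filter_upwards [hφ0.eventually (ge_mem_nhds hδ)] with k hk
    have hψ : ContDiff ℝ (⊤ : ℕ∞) ((φ k).normed volume) := (φ k).contDiff_normed
    have hsupp : Function.support ((φ k).normed volume) ⊆ closedBall 0 (φ k).rOut := by
      rw [(φ k).support_normed_eq]
      exact ball_subset_closedBall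
    have hball : ∀ w ∈ K, closedBall w (φ k).rOut ⊆ Ω := fun w hw =>
      ((closedBall_subset_closedBall hk).trans (closedBall_subset_cthickening hw δ)).trans hδK
    have hfk : ContDiff ℝ 2 (f k) :=
      HasCompactSupport.contDiff_convolution_left (n := 2) _
        (φ k).hasCompactSupport_normed (φ k).contDiff_normed (hUl u hu)
    have hgrad : ∀ i, gk k i x = fderiv ℝ (f k) x (EuclideanSpace.single i (1 : ℝ)) := fun i =>
      ((hg i).fderiv_convolution hu hψ hsupp (hball x hxK)).symm
    have hhess : ∀ w ∈ K, ‖fderiv ℝ (fderiv ℝ (f k)) w‖ₑ ≤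
        c * maximalFunction volume (hessianSize Ω h) w := by
      intro w hw
      refine (opENorm_le_sum _).trans ?_
      calc _ ≤ ∑ i : Fin n, ∑ j : Fin n, ENNReal.ofReal (2 ^ n) *
            maximalFunction volume (hessianSize Ω h) w := by
            refine Finset.sum_le_sum fun i _ => Finset.sum_le_sum fun j _ => ?_
            rw [(hh i j).fderiv_fderiv_convolution hu hψ hsupp (hball w hw)]
            refine (enorm_convolution_normed_le (φ k) (hφ2 k) _ w).trans ?_
            gcongr
            exact hM i j w
        _ = _ := by
            simp only [Finset.sum_const, Finset.card_univ, Fintype.card_fin, nsmul_eq_mul, hc]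
            push_cast
            ring
    have key := hC (f k) (fun w => c * maximalFunction volume (hessianSize Ω h) w) x y z hfk
      ((measurable_maximalFunction _ _).const_mul c) hz (fun b hb w hw => hhess w
        (hw.imp (fun hw => mem_biUnion (ball_subset_closedBall hb) hw)
          fun hw => mem_biUnion (ball_subset_closedBall hb) hw))
    simp only [ENNReal.mul_rpow_of_nonneg _ _ hp0.le] at key
    rw [maximalFunction_const_mul _ (ENNReal.rpow_ne_top_of_nonneg hp0.le hc'),
      ENNReal.mul_rpow_of_nonneg _ _ (by positivity), ← ENNReal.rpow_mul,
      mul_one_div_cancel hp0.ne', ENNReal.rpow_one, hlin k] at key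
    simp only [hgrad]
    refine key.trans_eq ?_
    rw [ENNReal.coe_mul, ENNReal.coe_toNNReal hc', iteratedMaximal]
    ring
  refine le_of_tendsto ?_ hbound
  refine (continuous_enorm.tendsto _).comp ((hyu.sub hxu).sub ?_)
  exact tendsto_finsetSum _ fun i _ => (hxg i).const_mul _

end SobolevTaylor

/-! ### The opening function -/

section Opening

variable {n : ℕ} {Ω : Set (EuclideanSpace ℝ (Fin n))} {v : EuclideanSpace ℝ (Fin n) → ℝ}

theorem lowerTheta_eq_upperTheta_neg (v : EuclideanSpace ℝ (Fin n) → ℝ)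
    (Ω : Set (EuclideanSpace ℝ (Fin n))) (x : EuclideanSpace ℝ (Fin n)) :
    lowerTheta v Ω x = upperTheta (-v) Ω x := by
  unfold lowerTheta upperTheta
  congr 1
  ext t
  constructor
  · rintro ⟨M, P, ⟨hM, l₀, l, hP⟩, ⟨hle, hx⟩, rfl⟩
    refine ⟨M, -P, ⟨hM, -l₀, -l, fun y => ?_⟩, ⟨fun y hy => neg_le_neg (hle y hy), ?_⟩, rfl⟩
    · rw [Pi.neg_apply, hP, LinearMap.neg_apply]
      ring
    · rw [Pi.neg_apply, Pi.neg_apply, hx]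
  · rintro ⟨M, P, ⟨hM, l₀, l, hP⟩, ⟨hle, hx⟩, rfl⟩
    refine ⟨M, -P, ⟨hM, -l₀, -l, fun y => ?_⟩, ⟨fun y hy => neg_le.1 (hle y hy), ?_⟩, rfl⟩
    · rw [Pi.neg_apply, hP, LinearMap.neg_apply]
      ring
    · rw [Pi.neg_apply, ← hx, Pi.neg_apply, neg_neg]

theorem upperTheta_le {x p : EuclideanSpace ℝ (Fin n)} {β : ℝ} (hβ : 0 < β)
    (h : ∀ y ∈ Ω, v y ≤ v x + ⟪p, y - x⟫ + β / 2 * ‖y - x‖ ^ 2) :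
    upperTheta v Ω x ≤ ENNReal.ofReal β := by
  refine sInf_le ⟨β, fun y => v x + ⟪p, y - x⟫ + β / 2 * ‖y - x‖ ^ 2, ⟨hβ,
    v x - ⟪p, x⟫ + β / 2 * ‖x‖ ^ 2, (innerₛₗ ℝ p - β • innerₛₗ ℝ x), fun y => ?_⟩,
    ⟨h, by simp⟩, rfl⟩
  simp only [LinearMap.sub_apply, LinearMap.smul_apply, innerₛₗ_apply_apply, smul_eq_mul,
    inner_sub_right, norm_sub_sq_real, real_inner_comm y x]
  ring

/-- A touching paraboloid is recentred at `x`, where its gradient is that of the linear part plus `M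
• x`; raising the opening from `M` to `β` keeps it above `v`. -/
theorem exists_of_upperTheta_lt {x : EuclideanSpace ℝ (Fin n)} {β : ℝ}
    (h : upperTheta v Ω x < ENNReal.ofReal β) :
    ∃ p, ∀ y ∈ Ω, v y ≤ v x + ⟪p, y - x⟫ + β / 2 * ‖y - x‖ ^ 2 := by
  obtain ⟨_, ⟨M, P, ⟨hM, l₀, l, hP⟩, ⟨hle, hx⟩, rfl⟩, hlt⟩ := sInf_lt_iff.1 h
  have hMβ : M < β := (ENNReal.ofReal_lt_ofReal_iff_of_nonneg hM.le).1 hlt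
  set q := (InnerProductSpace.toDual ℝ (EuclideanSpace ℝ (Fin n))).symm l.toContinuousLinearMap
  have hq : ∀ y, ⟪q, y⟫ = l y := fun y => InnerProductSpace.toDual_symm_apply
  refine ⟨q + M • x, fun y hy => (hle y hy).trans ?_⟩
  rw [hx, hP, hP, inner_add_left, hq, map_sub, inner_smul_left, inner_sub_right,
    real_inner_self_eq_norm_sq, norm_sub_sq_real, real_inner_comm y x]
  have h2 := mul_nonneg (sub_nonneg.2 hMβ.le) (sq_nonneg ‖y - x‖)
  rw [norm_sub_sq_real] at h2
  simp only [conj_trivial]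
  linarith

/-- If points tending to `x` have openings below `β`, local boundedness of `v` bounds their slopes,
and a limit slope gives a paraboloid of opening `β` at `x`. -/
theorem lowerSemicontinuous_indicator_upperTheta (hΩ : IsOpen Ω) (hv : ContinuousOn v Ω) :
    LowerSemicontinuous (Ω.indicator (upperTheta v Ω)) := by
  intro x a ha
  have hx : x ∈ Ω := by
    by_contra hx
    rw [indicator_of_notMem hx] at ha
    exact not_lt_zero ha
  rw [indicator_of_mem hx] at ha
  obtain ⟨b, hab, hb⟩ := exists_between ha
  have hbt : b ≠ ⊤ := hb.ne_top
  have hb0 : 0 < b.toReal := ENNReal.toReal_pos (bot_lt_of_lt hab).ne' hbt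
  set β := b.toReal with hβ
  have hbβ : b = ENNReal.ofReal β := (ENNReal.ofReal_toReal hbt).symm
  by_contra hcon
  have hfreq : ∃ᶠ y in 𝓝 x, y ∈ Ω ∧ upperTheta v Ω y < b := by
    refine ((not_eventually.1 hcon).and_eventually (hΩ.eventually_mem hx)).mono ?_
    rintro y ⟨hy, hyΩ⟩
    change ¬a < Ω.indicator (upperTheta v Ω) y at hy
    rw [indicator_of_mem hyΩ, not_lt] at hy
    exact ⟨hyΩ, hy.trans_lt hab⟩
  obtain ⟨w, hw, hwp⟩ := exists_seq_forall_of_frequently hfreq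
  choose p hp using fun k => exists_of_upperTheta_lt (hbβ ▸ (hwp k).2)
  obtain ⟨δ, hδ, hball⟩ := Metric.nhds_basis_closedBall.mem_iff.1 (hΩ.mem_nhds hx)
  obtain ⟨B, hB⟩ := (isCompact_closedBall x δ).exists_bound_of_continuousOn (hv.mono hball)
  have hev : ∀ᶠ k in atTop, p k ∈ closedBall 0 ((2 * B + β / 2 * (δ / 2) ^ 2) / (δ / 2)) := by
    filter_upwards [hw.eventually (closedBall_mem_nhds x (half_pos hδ))] with k hk
    rw [mem_closedBall_zero_iff, le_div_iff₀ (half_pos hδ)]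
    rcases eq_or_ne (p k) 0 with h0 | h0
    · rw [h0, norm_zero, zero_mul]
      have : 0 ≤ B := (norm_nonneg _).trans (hB x (mem_closedBall_self hδ.le))
      positivity
    have hn : ‖p k‖ ≠ 0 := norm_ne_zero_iff.2 h0
    -- Moving by `δ / 2` against the slope lowers the linear part by `‖p k‖ * (δ / 2)`, which the
    -- bound `B` on `|v|` must accommodate.
    set y := w k - (δ / 2 / ‖p k‖) • p k with hy
    have hyw : y - w k = -((δ / 2 / ‖p k‖) • p k) := by rw [hy]; abel
    have hnorm : ‖y - w k‖ = δ / 2 := by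
      rw [hyw, norm_neg, norm_smul, Real.norm_of_nonneg (by positivity), div_mul_cancel₀ _ hn]
    rw [dist_eq_norm] at hk
    have hyb : y ∈ closedBall x δ := by
      rw [mem_closedBall, dist_eq_norm]
      have := norm_sub_le_norm_sub_add_norm_sub y (w k) x
      linarith
    have hwb : w k ∈ closedBall x δ := by
      rw [mem_closedBall, dist_eq_norm]
      linarith
    have h1 := hp k y (hball hyb)
    rw [hnorm, hyw, inner_neg_right, inner_smul_right, real_inner_self_eq_norm_sq] at h1
    have e : δ / 2 / ‖p k‖ * ‖p k‖ ^ 2 = ‖p k‖ * (δ / 2) := by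
      field_simp
    rw [e] at h1
    have h2 := neg_le_of_abs_le (hB y hyb)
    have h3 := le_of_abs_le (hB (w k) hwb)
    linarith
  obtain ⟨p₀, -, φ, hφ, hlim⟩ := tendsto_subseq_of_frequently_bounded isBounded_closedBall
    hev.frequently
  refine (upperTheta_le (p := p₀) hb0 fun y hy => ?_).not_gt (hbβ ▸ hb)
  have hwφ : Tendsto (w ∘ φ) atTop (𝓝 x) := hw.comp hφ.tendsto_atTop
  have hvx : Tendsto (fun k => v (w (φ k))) atTop (𝓝 (v x)) :=
    (hv.continuousAt (hΩ.mem_nhds hx)).tendsto.comp hwφ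
  have hsub : Tendsto (fun k => y - w (φ k)) atTop (𝓝 (y - x)) := tendsto_const_nhds.sub hwφ
  exact ge_of_tendsto' ((hvx.add (hlim.inner hsub)).add ((hsub.norm.pow 2).const_mul _))
    fun k => hp (φ k) y hy

theorem aestronglyMeasurable_Theta (hΩ : IsOpen Ω) (hv : ContinuousOn v Ω) :
    AEStronglyMeasurable (Theta v Ω) (volume.restrict Ω) := by
  have h1 := (lowerSemicontinuous_indicator_upperTheta hΩ hv).measurable
  have h2 := (lowerSemicontinuous_indicator_upperTheta hΩ hv.neg).measurable
  refine ((h1.max h2).aestronglyMeasurable (μ := volume.restrict Ω)).congr ?_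
  filter_upwards [ae_restrict_mem hΩ.measurableSet] with x hx
  rw [Theta, lowerTheta_eq_upperTheta_neg, indicator_of_mem hx, indicator_of_mem hx]

/-- The factor 2 comes from writing a paraboloid of opening `M` with coefficient `M / 2`. -/
theorem Theta_le {x p : EuclideanSpace ℝ (Fin n)} {T : ℝ≥0∞}
    (h : ∀ y ∈ Ω, ‖v y - v x - ⟪p, y - x⟫‖ₑ ≤ T * ‖y - x‖ₑ ^ 2) :
    Theta v Ω x ≤ 2 * T := by
  rcases eq_or_ne T ⊤ with rfl | hT
  · simp
  have hreal : ∀ y ∈ Ω, |v y - v x - ⟪p, y - x⟫| ≤ T.toReal * ‖y - x‖ ^ 2 := by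
    intro y hy
    have := h y hy
    rwa [← ENNReal.ofReal_toReal hT, ← ofReal_norm (y - x), ← ENNReal.ofReal_pow (norm_nonneg _),
      ← ENNReal.ofReal_mul ENNReal.toReal_nonneg, ← ofReal_norm,
      ENNReal.ofReal_le_ofReal_iff (by positivity)] at this
  -- Openings must be positive while `T` may vanish, hence the extra `ε`.
  refine ENNReal.le_of_forall_pos_le_add fun ε hε _ => ?_
  have hT0 : 0 ≤ T.toReal := ENNReal.toReal_nonneg
  have hε' : (0 : ℝ) < ε := hε
  have e : 2 * T + ε = ENNReal.ofReal (2 * T.toReal + ε) := by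
    rw [ENNReal.ofReal_add (by positivity) ε.coe_nonneg, ENNReal.ofReal_mul (by norm_num),
      ENNReal.ofReal_toReal hT, ENNReal.ofReal_coe_nnreal]
    simp
  have hle : ∀ y, T.toReal * ‖y - x‖ ^ 2 ≤ (2 * T.toReal + ε) / 2 * ‖y - x‖ ^ 2 := fun y => by
    gcongr
    linarith
  rw [e, Theta, lowerTheta_eq_upperTheta_neg]
  refine max_le (upperTheta_le (p := p) (by positivity) fun y hy => ?_)
    (upperTheta_le (p := -p) (by positivity) fun y hy => ?_)
  · linarith [le_of_abs_le (hreal y hy), hle y]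
  · rw [inner_neg_left, Pi.neg_apply, Pi.neg_apply]
    linarith [neg_le_of_abs_le (hreal y hy), hle y]

end Opening

/-! ### Sobolev norms -/

section SobolevNorm

variable {n m : ℕ} {Ω : Opens (EuclideanSpace ℝ (Fin n))} {p : ℝ≥0∞}
  {u : EuclideanSpace ℝ (Fin n) → ℝ}

theorem MemSobolev.hasWeakDeriv (hu : MemSobolev Ω m p u) {k : ℕ} (hk : k ≤ m)
    (I : Fin k → Fin n) : HasWeakDeriv Ω I u (weakDeriv Ω I u) := by
  have h : ∃ g, HasWeakDeriv Ω I u g := (hu k hk I).imp fun _ hg => hg.1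
  rw [weakDeriv, dif_pos h]
  exact h.choose_spec

theorem MemSobolev.memLp_weakDeriv (hu : MemSobolev Ω m p u) {k : ℕ} (hk : k ≤ m)
    (I : Fin k → Fin n) : MemLp (weakDeriv Ω I u) p (volume.restrict Ω) := by
  obtain ⟨g, hg, hgp⟩ := hu k hk I
  exact hgp.ae_eq (hg.ae_eq (hu.hasWeakDeriv hk I))

theorem eLpNorm_weakDeriv_le_sobolevNorm {k : ℕ} (hk : k ≤ m) (I : Fin k → Fin n) :
    eLpNorm (weakDeriv Ω I u) p (volume.restrict Ω) ≤ sobolevNorm Ω m p u :=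
  (Finset.single_le_sum (f := fun I : Fin k → Fin n =>
      eLpNorm (weakDeriv Ω I u) p (volume.restrict Ω)) (fun _ _ => zero_le)
      (Finset.mem_univ I)).trans
    (Finset.single_le_sum (f := fun k => ∑ I : Fin k → Fin n,
      eLpNorm (weakDeriv Ω I u) p (volume.restrict Ω)) (fun _ _ => zero_le)
      (Finset.mem_range_succ_iff.2 hk))

theorem MemSobolev.sobolevNorm_lt_top (hu : MemSobolev Ω m p u) : sobolevNorm Ω m p u < ⊤ :=
  ENNReal.sum_lt_top.2 fun _ hk => ENNReal.sum_lt_top.2 fun I _ =>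
    (hu.memLp_weakDeriv (Finset.mem_range_succ_iff.1 hk) I).eLpNorm_lt_top

theorem MemSobolev.weakDeriv_zero_ae_eq (hu : MemSobolev Ω m p u) (I : Fin 0 → Fin n) :
    weakDeriv Ω I u =ᵐ[volume.restrict Ω] u := by
  have h := hu.hasWeakDeriv (Nat.zero_le m) I
  refine h.ae_eq ⟨h.1, h.1, fun φ => ?_⟩
  simp [partialDeriv, iteratedFDeriv_zero_apply]

theorem MemSobolev.memLp (hu : MemSobolev Ω m p u) : MemLp u p (volume.restrict Ω) :=
  (hu.memLp_weakDeriv (Nat.zero_le m) Fin.elim0).ae_eq (hu.weakDeriv_zero_ae_eq _)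

theorem MemSobolev.eLpNorm_le_sobolevNorm (hu : MemSobolev Ω m p u) :
    eLpNorm u p (volume.restrict Ω) ≤ sobolevNorm Ω m p u := by
  rw [← eLpNorm_congr_ae (hu.weakDeriv_zero_ae_eq Fin.elim0)]
  exact eLpNorm_weakDeriv_le_sobolevNorm (Nat.zero_le m) _

end SobolevNorm

/-! ### Taylor expansions with integrable coefficients -/

section TaylorData

variable {n : ℕ}

/-- For almost all points `x` of `Ω`, namely those of `G`, the function `u` has at `x` a first order
Taylor expansion with gradient `g x` and error at most `A x * ‖y - x‖ ^ 2`, at the points `y` of `G`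
at distance less than `r` of `x`. -/
structure HasTaylorExpansions (Ω : Set (EuclideanSpace ℝ (Fin n))) (r : ℝ)
    (u : EuclideanSpace ℝ (Fin n) → ℝ) (G : Set (EuclideanSpace ℝ (Fin n)))
    (g : EuclideanSpace ℝ (Fin n) → EuclideanSpace ℝ (Fin n))
    (A : EuclideanSpace ℝ (Fin n) → ℝ≥0∞) : Prop where
  subset : G ⊆ Ω
  ae_mem : ∀ᵐ x ∂volume.restrict Ω, x ∈ G
  enorm_le : ∀ x ∈ G, ∀ y ∈ G, dist x y < r →
    ‖u y - u x - ⟪g x, y - x⟫‖ₑ ≤ A x * ‖y - x‖ₑ ^ 2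

theorem enorm_le_sum_enorm (w : EuclideanSpace ℝ (Fin n)) : ‖w‖ₑ ≤ ∑ i, ‖w i‖ₑ := by
  have h : w = ∑ i, w i • EuclideanSpace.single i (1 : ℝ) := by
    ext k
    simp [Pi.single_apply]
  conv_lhs => rw [h]
  refine (enorm_sum_le _ _).trans (Finset.sum_le_sum fun i _ => ?_)
  rw [enorm_smul]
  simp [← ofReal_norm]

theorem eLpNorm_hessianSize_le {Ω : Set (EuclideanSpace ℝ (Fin n))} (hΩ : MeasurableSet Ω)
    {h : Fin n → Fin n → EuclideanSpace ℝ (Fin n) → ℝ} {p N : ℝ≥0∞} (hp : 1 ≤ p)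
    (hm : ∀ i j, AEStronglyMeasurable (h i j) (volume.restrict Ω))
    (hN : ∀ i j, eLpNorm (h i j) p (volume.restrict Ω) ≤ N) :
    eLpNorm (hessianSize Ω h) p volume ≤ (n ^ 2 : ℕ) * N := by
  have e : hessianSize Ω h = ∑ i, ∑ j, fun x => ‖Ω.indicator (h i j) x‖ₑ := by
    ext x
    simp [hessianSize]
  have hmi : ∀ i j, AEStronglyMeasurable (fun x => ‖Ω.indicator (h i j) x‖ₑ) volume := fun i j =>
    ((aestronglyMeasurable_indicator_iff hΩ).2 (hm i j)).enorm.aestronglyMeasurable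
  rw [e]
  calc _ ≤ ∑ i : Fin n, ∑ j : Fin n, N := by
        refine (eLpNorm_sum_le (fun i _ => ?_) hp).trans (Finset.sum_le_sum fun i _ => ?_)
        · exact Finset.aestronglyMeasurable_sum _ fun j _ => hmi i j
        · refine (eLpNorm_sum_le (fun j _ => hmi i j) hp).trans (Finset.sum_le_sum fun j _ => ?_)
          rw [eLpNorm_enorm, eLpNorm_indicator_eq_eLpNorm_restrict hΩ]
          exact hN i j
    _ = _ := by
        simp only [Finset.sum_const, Finset.card_univ, Fintype.card_fin, nsmul_eq_mul]
        push_cast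
        ring

/-- Sobolev functions have first order Taylor expansions with coefficients in `L^q`. -/
theorem IsBoundedC11Domain.exists_hasTaylorExpansions (hn : 2 ≤ n) {q : ℝ} (hq : (n : ℝ) / 2 < q)
    {Ω : Opens (EuclideanSpace ℝ (Fin n))}
    (hΩ : IsBoundedC11Domain (Ω : Set (EuclideanSpace ℝ (Fin n)))) :
    ∃ r > 0, ∃ C : ℝ≥0, ∀ u : EuclideanSpace ℝ (Fin n) → ℝ,
      MemSobolev Ω 2 (ENNReal.ofReal q) u →
      ∃ G g A, HasTaylorExpansions (Ω : Set (EuclideanSpace ℝ (Fin n))) r u G g A ∧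
        AEStronglyMeasurable g (volume.restrict Ω) ∧ Measurable A ∧
        eLpNorm g (ENNReal.ofReal q) (volume.restrict Ω) ≤
          C * sobolevNorm Ω 2 (ENNReal.ofReal q) u ∧
        eLpNorm A (ENNReal.ofReal q) (volume.restrict Ω) ≤
          C * sobolevNorm Ω 2 (ENNReal.ofReal q) u := by
  have hn' : (2 : ℝ) ≤ n := by exact_mod_cast hn
  -- `p > n / 2` serves the Taylor estimate, `p < q` the bound for the iterated maximal function.
  obtain ⟨p, hp, hpq⟩ := exists_between hq
  have hp1 : 1 < p := by linarith
  have hq0 : 0 < q := by linarith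
  have hQ1 : 1 ≤ ENNReal.ofReal q := ENNReal.one_le_ofReal.2 (by linarith)
  have : NeZero n := ⟨by omega⟩
  obtain ⟨r, hr, C₁, hC₁⟩ := hΩ.exists_taylor hp1 hp
  obtain ⟨C₂, hC₂⟩ := exists_lintegral_iteratedMaximal_rpow_le
    (volume : Measure (EuclideanSpace ℝ (Fin n))) hp1 hpq
  set C₃ : ℝ≥0 := C₁ * (C₂ ^ (1 / q) * (n ^ 2 : ℕ)) with hC₃
  have : IsFiniteMeasure (volume.restrict (Ω : Set (EuclideanSpace ℝ (Fin n)))) :=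
    ⟨by simpa using hΩ.isBounded.measure_lt_top⟩
  refine ⟨r, hr, max n C₃, fun u hu => ?_⟩
  set N := sobolevNorm Ω 2 (ENNReal.ofReal q) u with hN
  set Q := ENNReal.ofReal q with hQ
  have hint : ∀ {w : EuclideanSpace ℝ (Fin n) → ℝ}, MemLp w Q (volume.restrict Ω) →
      IntegrableOn w Ω := fun hw => hw.integrable hQ1
  set gi : Fin n → EuclideanSpace ℝ (Fin n) → ℝ := fun i => weakDeriv Ω ![i] u with hgi
  set h : Fin n → Fin n → EuclideanSpace ℝ (Fin n) → ℝ := fun i j => weakDeriv Ω ![i, j] u with hh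
  have hgm : ∀ i, MemLp (gi i) Q (volume.restrict Ω) := fun i =>
    hu.memLp_weakDeriv one_le_two ![i]
  have hhm : ∀ i j, MemLp (h i j) Q (volume.restrict Ω) := fun i j =>
    hu.memLp_weakDeriv le_rfl ![i, j]
  obtain ⟨G, hGΩ, hGae, hG⟩ := hC₁ u gi h (hint hu.memLp)
    (fun i => hu.hasWeakDeriv one_le_two ![i]) (fun i => hint (hgm i))
    (fun i j => hu.hasWeakDeriv le_rfl ![i, j])
  set B := iteratedMaximal volume p (hessianSize (Ω : Set (EuclideanSpace ℝ (Fin n))) h) with hB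
  have hBm : Measurable B := measurable_iteratedMaximal _ _ _
  set g : EuclideanSpace ℝ (Fin n) → EuclideanSpace ℝ (Fin n) :=
    fun x => WithLp.toLp 2 fun i => gi i x with hg
  refine ⟨G, g, fun x => C₁ * B x, ⟨hGΩ, hGae, fun x hx y hy hxy => ?_⟩, ?_,
    hBm.const_mul _, ?_, ?_⟩
  · have := hG x hx y hy hxy
    have e : ⟪g x, y - x⟫ = ∑ i, (y i - x i) * gi i x := by
      simp [hg, PiLp.inner_apply]
    rw [e]
    refine this.trans_eq ?_
    ring
  · refine (PiLp.continuous_toLp 2 _).comp_aestronglyMeasurable ?_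
    exact (aemeasurable_pi_lambda _ fun i => (hgm i).1.aemeasurable).aestronglyMeasurable
  · calc eLpNorm g Q (volume.restrict Ω)
        ≤ eLpNorm (∑ i, fun x => ‖gi i x‖ₑ) Q (volume.restrict Ω) := by
          refine eLpNorm_mono_enorm fun x => (enorm_le_sum_enorm _).trans_eq ?_
          simp [hg]
      _ ≤ ∑ i : Fin n, N := by
          refine (eLpNorm_sum_le (fun i _ => (hgm i).1.enorm.aestronglyMeasurable) hQ1).trans
            (Finset.sum_le_sum fun i _ => ?_)
          rw [eLpNorm_enorm]
          exact eLpNorm_weakDeriv_le_sobolevNorm one_le_two _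
      _ ≤ _ := by
          simp only [Finset.sum_const, Finset.card_univ, Fintype.card_fin, nsmul_eq_mul]
          gcongr
          exact_mod_cast le_max_left _ _
  · have hQ0 : Q ≠ 0 := (zero_lt_one.trans_le hQ1).ne'
    have hQt : Q.toReal = q := ENNReal.toReal_ofReal hq0.le
    have hF := eLpNorm_hessianSize_le Ω.isOpen.measurableSet hQ1 (fun i j => (hhm i j).1)
      (N := N) fun i j => eLpNorm_weakDeriv_le_sobolevNorm le_rfl _
    have hFm : AEMeasurable (hessianSize (Ω : Set (EuclideanSpace ℝ (Fin n))) h) := by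
      refine Finset.aemeasurable_fun_sum _ fun i _ => Finset.aemeasurable_fun_sum _ fun j _ => ?_
      exact ((aestronglyMeasurable_indicator_iff Ω.isOpen.measurableSet).2 (hhm i j).1).enorm
    have hBQ : eLpNorm B Q volume ≤ C₂ ^ (1 / q) * ((n ^ 2 : ℕ) * N) := by
      refine le_trans ?_ (mul_le_mul_right hF _)
      rw [eLpNorm_eq_lintegral_rpow_enorm_toReal hQ0 ENNReal.ofReal_ne_top,
        eLpNorm_eq_lintegral_rpow_enorm_toReal hQ0 ENNReal.ofReal_ne_top, hQt,
        ← ENNReal.mul_rpow_of_nonneg _ _ (by positivity)]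
      gcongr
      exact hC₂ _ hFm
    calc _ ≤ C₁ • eLpNorm B Q (volume.restrict Ω) :=
          eLpNorm_le_nnreal_smul_eLpNorm_of_ae_le_mul' (Eventually.of_forall fun x => by simp) Q
      _ ≤ C₁ • (C₂ ^ (1 / q) * ((n ^ 2 : ℕ) * N)) := by
          gcongr
          exact (eLpNorm_mono_measure _ Measure.restrict_le_self).trans hBQ
      _ = C₃ * N := by
          rw [hC₃, ENNReal.smul_def, smul_eq_mul, ENNReal.coe_mul, ENNReal.coe_mul,
            ENNReal.coe_rpow_of_nonneg _ (by positivity)]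
          push_cast
          ring
      _ ≤ _ := by
          gcongr
          exact le_max_right _ _

end TaylorData

/-! ### Consequences of the Taylor expansions -/

section Consequences

variable {n : ℕ} {Ω : Set (EuclideanSpace ℝ (Fin n))} {r : ℝ}
  {u v : EuclideanSpace ℝ (Fin n) → ℝ} {G : Set (EuclideanSpace ℝ (Fin n))}
  {g : EuclideanSpace ℝ (Fin n) → EuclideanSpace ℝ (Fin n)}
  {A : EuclideanSpace ℝ (Fin n) → ℝ≥0∞}

theorem subset_closure_of_ae_mem (hΩ : IsOpen Ω) (hG : ∀ᵐ x ∂volume.restrict Ω, x ∈ G) :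
    Ω ⊆ closure (Ω ∩ G) := by
  have hd := Measure.dense_of_ae ((ae_restrict_iff' hΩ.measurableSet).1 hG)
  refine (hd.open_subset_closure_inter hΩ).trans (closure_mono ?_)
  exact fun x hx => ⟨hx.1, hx.2 hx.1⟩

/-- If `A ∈ L^q` with `q > n / 2`, there are points `x` close to `x₀`, say at distance less than
`ρ`, at which `A x * ρ ^ 2` is small. -/
theorem exists_mul_sq_le {q : ℝ} (hq0 : 0 < q) (hq : (n : ℝ) / 2 < q) (hΩ : IsOpen Ω)
    (hAq : ∫⁻ x in Ω, A x ^ q ≠ ⊤) (hG : ∀ᵐ x ∂volume.restrict Ω, x ∈ G)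
    {x₀ : EuclideanSpace ℝ (Fin n)} (hx₀ : x₀ ∈ Ω) {η R : ℝ} (hη : 0 < η) (hR : 0 < R) :
    ∃ ρ, 0 < ρ ∧ ρ < R ∧ ∃ x ∈ G, x ∈ ball x₀ ρ ∧
      A x * ENNReal.ofReal (ρ ^ 2) ≤ ENNReal.ofReal η := by
  set I := ∫⁻ x in Ω, A x ^ q with hI
  set V := volume (ball (0 : EuclideanSpace ℝ (Fin n)) 1) with hV
  have hV0 : V ≠ 0 := (measure_ball_pos _ _ one_pos).ne'
  have hVt : V ≠ ⊤ := measure_ball_lt_top.ne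
  obtain ⟨δ, hδ, hball⟩ := Metric.isOpen_iff.1 hΩ x₀ hx₀
  -- If `A > η / ρ ^ 2` almost everywhere on the ball, then `∫ A ^ q` is at least `η ^ q * ρ ^ (n -
  -- 2 * q) * V`, which is unbounded as `ρ` tends to 0.
  have hlim := tendsto_rpow_neg_nhdsGT_zero (y := n - 2 * q) (by linarith)
  obtain ⟨ρ, hρ1, hρ0, hρR⟩ := ((hlim.eventually_gt_atTop ((I / V).toReal / η ^ q)).and
    (Ioo_mem_nhdsGT (lt_min hR hδ))).exists
  refine ⟨ρ, hρ0, hρR.trans_le (min_le_left _ _), ?_⟩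
  by_contra! hcon
  have hsub : ball x₀ ρ ⊆ Ω := (ball_subset_ball (hρR.le.trans (min_le_right _ _))).trans hball
  have hae : ∀ᵐ x ∂volume.restrict (ball x₀ ρ), ENNReal.ofReal ((η / ρ ^ 2) ^ q) ≤ A x ^ q := by
    filter_upwards [ae_restrict_of_ae_restrict_of_subset hsub hG,
      ae_restrict_mem measurableSet_ball]
      with x hxG hxb
    have h1 := (hcon x hxG hxb).le
    rw [← ENNReal.ofReal_rpow_of_nonneg (by positivity) hq0.le]
    gcongr
    rw [ENNReal.ofReal_div_of_pos (by positivity)]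
    exact ENNReal.div_le_of_le_mul h1
  have h2 : ENNReal.ofReal ((η / ρ ^ 2) ^ q) * (ENNReal.ofReal (ρ ^ n) * V) ≤ I := by
    have e : volume (ball x₀ ρ) = ENNReal.ofReal (ρ ^ n) * V := by
      rw [Measure.addHaar_ball_of_pos _ _ hρ0, finrank_euclideanSpace_fin]
    rw [← e, ← setLIntegral_const]
    exact (lintegral_mono_ae hae).trans (lintegral_mono_set hsub)
  have e2 : (η / ρ ^ 2) ^ q * ρ ^ n = η ^ q * ρ ^ (n - 2 * q) := by
    rw [Real.div_rpow hη.le (by positivity), Real.rpow_sub hρ0, Real.rpow_natCast,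
      ← Real.rpow_natCast ρ 2, ← Real.rpow_mul hρ0.le]
    push_cast
    ring
  rw [← mul_assoc, ← ENNReal.ofReal_mul (by positivity), e2, ← ENNReal.le_div_iff_mul_le
    (Or.inl hV0) (Or.inl hVt), ENNReal.ofReal_le_iff_le_toReal (ENNReal.div_ne_top hAq hV0)] at h2
  rw [div_lt_iff₀ (by positivity)] at hρ1
  linarith

/-- If the error coefficient is in `L^q` with `q > n / 2`, then `u` has limits along `G`. -/
theorem HasTaylorExpansions.exists_tendsto (h : HasTaylorExpansions Ω r u G g A) (hΩ : IsOpen Ω)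
    (hr : 0 < r) {q : ℝ} (hq0 : 0 < q) (hq : (n : ℝ) / 2 < q)
    (hAq : ∫⁻ x in Ω, A x ^ q ≠ ⊤) {x₀ : EuclideanSpace ℝ (Fin n)} (hx₀ : x₀ ∈ Ω) :
    ∃ l, Tendsto u (𝓝[G] x₀) (𝓝 l) := by
  have hcl : x₀ ∈ closure G :=
    closure_mono inter_subset_right (subset_closure_of_ae_mem hΩ h.ae_mem hx₀)
  have hne : (𝓝[G] x₀).NeBot := mem_closure_iff_nhdsWithin_neBot.1 hcl
  rw [← cauchy_map_iff_exists_tendsto, Metric.cauchy_iff]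
  refine ⟨hne.map _, fun ε hε => ?_⟩
  obtain ⟨ρ, hρ0, hρr, x, hxG, hxb, hAx⟩ := exists_mul_sq_le hq0 hq hΩ hAq h.ae_mem hx₀
    (show 0 < ε / 16 by positivity) (half_pos hr)
  -- The reference point `x` is already fixed, so the radius may depend on `g x`: the linear part
  -- then varies by at most `ε / 4`, and each of the two Taylor errors is at most `4 * (ε / 16)`.
  set ρ' := min ρ (ε / (8 * (‖g x‖ + 1))) with hρ'
  have hρ'0 : 0 < ρ' := lt_min hρ0 (by positivity)
  have hone : ∀ y ∈ G, y ∈ ball x₀ ρ' → |u y - u x - ⟪g x, y - x⟫| ≤ ε / 4 := by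
    intro y hyG hyb
    have hd : dist x y < 2 * ρ := by
      have := dist_triangle_right x y x₀
      have h2 : dist y x₀ < ρ := lt_of_lt_of_le hyb (min_le_left _ _)
      have h3 : dist x x₀ < ρ := hxb
      linarith
    have h1 := h.enorm_le x hxG y hyG (by linarith)
    have h2 : ‖y - x‖ₑ ^ 2 ≤ 4 * ENNReal.ofReal (ρ ^ 2) := by
      have e : (4 : ℝ≥0∞) = ENNReal.ofReal 4 := by simp
      rw [e, ← ENNReal.ofReal_mul (by norm_num), ← ofReal_norm,
        ← ENNReal.ofReal_pow (norm_nonneg _), ← dist_eq_norm, dist_comm]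
      refine ENNReal.ofReal_le_ofReal ?_
      calc dist x y ^ 2 ≤ (2 * ρ) ^ 2 := by gcongr
        _ = _ := by ring
    have h3 : ‖u y - u x - ⟪g x, y - x⟫‖ₑ ≤ ENNReal.ofReal (ε / 4) := by
      refine h1.trans ((mul_le_mul_right h2 _).trans ?_)
      calc A x * (4 * ENNReal.ofReal (ρ ^ 2)) = 4 * (A x * ENNReal.ofReal (ρ ^ 2)) := by ring
        _ ≤ 4 * ENNReal.ofReal (ε / 16) := by gcongr
        _ = ENNReal.ofReal (ε / 4) := by
          have e : (4 : ℝ≥0∞) = ENNReal.ofReal 4 := by simp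
          rw [e, ← ENNReal.ofReal_mul (by norm_num)]
          congr 1
          ring
    rwa [← ofReal_norm, ENNReal.ofReal_le_ofReal_iff (by positivity)] at h3
  refine ⟨u '' (ball x₀ ρ' ∩ G), image_mem_map
    (inter_mem (nhdsWithin_le_nhds (ball_mem_nhds _ hρ'0)) self_mem_nhdsWithin), ?_⟩
  rintro _ ⟨y, ⟨hyb, hyG⟩, rfl⟩ _ ⟨z, ⟨hzb, hzG⟩, rfl⟩
  have hy := abs_le.1 (hone y hyG hyb)
  have hz := abs_le.1 (hone z hzG hzb)
  have hyz : ‖y - z‖ ≤ 2 * ρ' := by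
    rw [← dist_eq_norm]
    have := dist_triangle_right y z x₀
    rw [mem_ball] at hyb hzb
    linarith
  have hin : |⟪g x, y - z⟫| ≤ ε / 4 := by
    refine (abs_real_inner_le_norm _ _).trans ?_
    calc ‖g x‖ * ‖y - z‖ ≤ (‖g x‖ + 1) * (2 * (ε / (8 * (‖g x‖ + 1)))) := by
          gcongr
          · linarith
          · exact hyz.trans (by gcongr; exact min_le_right _ _)
      _ = ε / 4 := by
          field_simp
          norm_num
  have hsplit : ⟪g x, y - z⟫ = ⟪g x, y - x⟫ - ⟪g x, z - x⟫ := by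
    rw [← inner_sub_right, sub_sub_sub_cancel_right]
  have hin' := abs_le.1 hin
  rw [Real.dist_eq, abs_lt]
  constructor <;> linarith

/-- `G` is dense in `Ω`, so `u` extends continuously by its limits along `G`; at a point of `G` the
limit is the value of `u` there. -/
theorem HasTaylorExpansions.exists_continuousOn (h : HasTaylorExpansions Ω r u G g A)
    (hΩ : IsOpen Ω) (hr : 0 < r) {q : ℝ} (hq0 : 0 < q) (hq : (n : ℝ) / 2 < q)
    (hAq : ∫⁻ x in Ω, A x ^ q ≠ ⊤) :
    ∃ v, ContinuousOn v Ω ∧ v =ᵐ[volume.restrict Ω] u := by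
  have hlim : ∀ x ∈ Ω, ∃ l, Tendsto u (𝓝[G] x) (𝓝 l) := fun x hx =>
    h.exists_tendsto hΩ hr hq0 hq hAq hx
  have hcl : Ω ⊆ closure G :=
    (subset_closure_of_ae_mem hΩ h.ae_mem).trans (closure_mono inter_subset_right)
  refine ⟨extendFrom G u, continuousOn_extendFrom hcl hlim, ?_⟩
  filter_upwards [h.ae_mem] with x hx
  obtain ⟨l, hl⟩ := hlim x (h.subset hx)
  have hlx : u x = l :=
    tendsto_nhds_unique (tendsto_pure_nhds u x) (hl.mono_left (pure_le_nhdsWithin hx))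
  rw [extendFrom_eq (subset_closure hx) hl, hlx]

/-- For the continuous representative the expansions are valid at all the points of `Ω` near `x`. -/
theorem HasTaylorExpansions.enorm_le_of_continuousOn (h : HasTaylorExpansions Ω r u G g A)
    (hΩ : IsOpen Ω) (hv : ContinuousOn v Ω) (hvu : v =ᵐ[volume.restrict Ω] u)
    {x y : EuclideanSpace ℝ (Fin n)} (hx : x ∈ G) (hxv : v x = u x) (hy : y ∈ Ω)
    (hxy : dist x y < r) : ‖v y - v x - ⟪g x, y - x⟫‖ₑ ≤ A x * ‖y - x‖ₑ ^ 2 := by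
  rcases eq_or_ne y x with rfl | hyx
  · simp
  -- The infinite case is set apart so that multiplication by `A x` passes to the limit below.
  rcases eq_or_ne (A x) ⊤ with hAt | hAt
  · have : ‖y - x‖ₑ ^ 2 ≠ 0 := pow_ne_zero 2 (by simpa [sub_eq_zero] using hyx)
    rw [hAt, ENNReal.top_mul this]
    exact le_top
  set S := Ω ∩ {w | w ∈ G ∧ v w = u w} with hS
  have hcl : y ∈ closure S := subset_closure_of_ae_mem hΩ (h.ae_mem.and hvu) hy
  have hne : (𝓝[S] y).NeBot := mem_closure_iff_nhdsWithin_neBot.1 hcl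
  have hvt : Tendsto v (𝓝[S] y) (𝓝 (v y)) :=
    (hv y hy).mono_left (nhdsWithin_mono _ inter_subset_left)
  have hid : Tendsto (fun w => w - x) (𝓝[S] y) (𝓝 (y - x)) :=
    ((continuous_id.sub continuous_const).tendsto y).mono_left nhdsWithin_le_nhds
  have hR : Tendsto (fun w => A x * ‖w - x‖ₑ ^ 2) (𝓝[S] y) (𝓝 (A x * ‖y - x‖ₑ ^ 2)) :=
    ENNReal.Tendsto.const_mul (((ENNReal.continuous_pow 2).comp continuous_enorm).tendsto _ |>.comp hid)
      (Or.inr hAt)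
  have hL : Tendsto (fun w => ‖v w - v x - ⟪g x, w - x⟫‖ₑ) (𝓝[S] y)
      (𝓝 ‖v y - v x - ⟪g x, y - x⟫‖ₑ) :=
    (continuous_enorm.tendsto _).comp ((hvt.sub_const _).sub (tendsto_const_nhds.inner hid))
  refine le_of_tendsto_of_tendsto hL hR ?_
  have hev : ∀ᶠ w in 𝓝[S] y, dist x w < r :=
    nhdsWithin_le_nhds ((continuous_const.dist continuous_id).tendsto y |>.eventually_lt_const hxy)
  filter_upwards [hev, self_mem_nhdsWithin] with w hw hwS
  rw [hwS.2.2, hxv]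
  exact h.enorm_le x hx w hwS.2.1 hw

/-- For `y` within `r / 2` of `x₀ ∈ closure Ω`, the set contains the nonempty open set `ball x₀ (r /
2) ∩ Ω`; compactness makes the bound uniform. -/
theorem exists_le_volume_ball_inter (hΩ : IsOpen Ω) (hb : Bornology.IsBounded Ω) (hr : 0 < r) :
    ∃ m : ℝ≥0∞, m ≠ 0 ∧ ∀ y ∈ Ω, m ≤ volume (ball y r ∩ Ω) := by
  suffices H : ∃ m : ℝ≥0∞, m ≠ 0 ∧ ∀ y ∈ closure Ω, m ≤ volume (ball y r ∩ Ω) by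
    obtain ⟨m, hm, H⟩ := H
    exact ⟨m, hm, fun y hy => H y (subset_closure hy)⟩
  refine hb.isCompact_closure.induction_on
    (p := fun S => ∃ m : ℝ≥0∞, m ≠ 0 ∧ ∀ y ∈ S, m ≤ volume (ball y r ∩ Ω)) ?_ ?_ ?_ ?_
  · exact ⟨1, one_ne_zero, by simp⟩
  · rintro S T hST ⟨m, hm, H⟩
    exact ⟨m, hm, fun y hy => H y (hST hy)⟩
  · rintro S T ⟨m₁, hm₁, H₁⟩ ⟨m₂, hm₂, H₂⟩
    refine ⟨min m₁ m₂, (lt_min (pos_iff_ne_zero.2 hm₁) (pos_iff_ne_zero.2 hm₂)).ne', ?_⟩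
    rintro y (hy | hy)
    · exact (min_le_left _ _).trans (H₁ y hy)
    · exact (min_le_right _ _).trans (H₂ y hy)
  · intro x₀ hx₀
    have hne : (ball x₀ (r / 2) ∩ Ω).Nonempty :=
      mem_closure_iff_nhds.1 hx₀ _ (ball_mem_nhds _ (half_pos hr))
    refine ⟨ball x₀ (r / 2), mem_nhdsWithin_of_mem_nhds (ball_mem_nhds _ (half_pos hr)),
      volume (ball x₀ (r / 2) ∩ Ω), ((isOpen_ball.inter hΩ).measure_pos _ hne).ne', ?_⟩
    intro y hy
    refine measure_mono (inter_subset_inter_left _ fun w hw => ?_)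
    rw [mem_ball] at *
    have := dist_triangle_right w y x₀
    linarith

/-- A continuous function with Taylor expansions is bounded in terms of an `L^1` norm. -/
theorem HasTaylorExpansions.mul_enorm_le (h : HasTaylorExpansions Ω r u G g A)
    (hΩ : IsOpen Ω) (hv : ContinuousOn v Ω) (hvu : v =ᵐ[volume.restrict Ω] u) {m : ℝ≥0∞}
    (hm : ∀ y ∈ Ω, m ≤ volume (ball y r ∩ Ω)) {y : EuclideanSpace ℝ (Fin n)} (hy : y ∈ Ω) :
    m * ‖v y‖ₑ ≤ ∫⁻ x in Ω, (‖u x‖ₑ + ENNReal.ofReal r * ‖g x‖ₑ + ENNReal.ofReal r ^ 2 * A x) := by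
  -- Here `y` is fixed and the base point `x` varies; integrating in `x` turns the expansions into a
  -- pointwise bound at `y`.
  have hae : ∀ᵐ x ∂volume.restrict (ball y r ∩ Ω),
      ‖v y‖ₑ ≤ ‖u x‖ₑ + ENNReal.ofReal r * ‖g x‖ₑ + ENNReal.ofReal r ^ 2 * A x := by
    filter_upwards [ae_restrict_of_ae_restrict_of_subset inter_subset_right h.ae_mem,
      ae_restrict_of_ae_restrict_of_subset inter_subset_right hvu,
      ae_restrict_mem (isOpen_ball.inter hΩ).measurableSet] with x hxG hxv hxm
    have hxy : dist x y < r := hxm.1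
    have h1 := h.enorm_le_of_continuousOn hΩ hv hvu hxG hxv hy hxy
    have h2 : ‖y - x‖ₑ ≤ ENNReal.ofReal r := by
      rw [← ofReal_norm, ← dist_eq_norm, dist_comm]
      exact ENNReal.ofReal_le_ofReal hxy.le
    have h3 : ‖⟪g x, y - x⟫‖ₑ ≤ ‖g x‖ₑ * ‖y - x‖ₑ := by
      rw [← ofReal_norm, ← ofReal_norm, ← ofReal_norm, ← ENNReal.ofReal_mul (norm_nonneg _)]
      exact ENNReal.ofReal_le_ofReal (norm_inner_le_norm _ _)
    calc ‖v y‖ₑ = ‖v x + ⟪g x, y - x⟫ + (v y - v x - ⟪g x, y - x⟫)‖ₑ := by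
          congr 1
          ring
      _ ≤ ‖v x‖ₑ + ‖⟪g x, y - x⟫‖ₑ + ‖v y - v x - ⟪g x, y - x⟫‖ₑ :=
          (enorm_add_le _ _).trans (add_le_add_left (enorm_add_le _ _) _)
      _ ≤ ‖u x‖ₑ + ENNReal.ofReal r * ‖g x‖ₑ + ENNReal.ofReal r ^ 2 * A x := by
          rw [hxv] at h1 ⊢
          gcongr
          · rw [mul_comm]
            exact h3.trans (by gcongr)
          · rw [mul_comm]
            exact h1.trans (by gcongr)
  calc m * ‖v y‖ₑ ≤ volume (ball y r ∩ Ω) * ‖v y‖ₑ := by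
        gcongr
        exact hm y hy
    _ = ∫⁻ _ in ball y r ∩ Ω, ‖v y‖ₑ := by rw [setLIntegral_const, mul_comm]
    _ ≤ _ := (lintegral_mono_ae hae).trans (lintegral_mono_set inter_subset_right)

/-- The opening function is bounded almost everywhere by the coefficients of the expansions. -/
theorem HasTaylorExpansions.ae_Theta_le (h : HasTaylorExpansions Ω r u G g A)
    (hΩ : IsOpen Ω) (hr : 0 < r) (hv : ContinuousOn v Ω) (hvu : v =ᵐ[volume.restrict Ω] u)
    {B : ℝ≥0∞} (hB : ∀ y ∈ Ω, ‖v y‖ₑ ≤ B) :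
    ∀ᵐ x ∂volume.restrict Ω, Theta v Ω x ≤
      2 * (A x + ENNReal.ofReal r⁻¹ * ‖g x‖ₑ + ENNReal.ofReal r⁻¹ ^ 2 * (2 * B)) := by
  filter_upwards [h.ae_mem, hvu] with x hxG hxv
  refine Theta_le (p := g x) fun y hy => ?_
  set R := ENNReal.ofReal r⁻¹ with hR
  rcases lt_or_ge (dist x y) r with hxy | hxy
  · refine (h.enorm_le_of_continuousOn hΩ hv hvu hxG hxv hy hxy).trans ?_
    gcongr
    rw [add_assoc]
    exact le_self_add
  -- At distance at least `r`, constant and linear terms are dominated by quadratic ones.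
  have h1 : 1 ≤ R * ‖y - x‖ₑ := by
    rw [hR, ← ofReal_norm, ← dist_eq_norm, dist_comm, ← ENNReal.ofReal_mul (by positivity),
      ENNReal.one_le_ofReal, ← div_eq_inv_mul, one_le_div hr]
    exact hxy
  have h3 : ‖⟪g x, y - x⟫‖ₑ ≤ ‖g x‖ₑ * ‖y - x‖ₑ := by
    rw [← ofReal_norm, ← ofReal_norm, ← ofReal_norm, ← ENNReal.ofReal_mul (norm_nonneg _)]
    exact ENNReal.ofReal_le_ofReal (norm_inner_le_norm _ _)
  calc ‖v y - v x - ⟪g x, y - x⟫‖ₑ ≤ ‖v y‖ₑ + ‖v x‖ₑ + ‖⟪g x, y - x⟫‖ₑ :=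
        enorm_sub_le.trans (add_le_add_left enorm_sub_le _)
    _ ≤ B + B + ‖g x‖ₑ * ‖y - x‖ₑ :=
        add_le_add (add_le_add (hB y hy) (hB x (h.subset hxG))) h3
    _ = 2 * B * 1 ^ 2 + ‖g x‖ₑ * ‖y - x‖ₑ * 1 := by ring
    _ ≤ 2 * B * (R * ‖y - x‖ₑ) ^ 2 + ‖g x‖ₑ * ‖y - x‖ₑ * (R * ‖y - x‖ₑ) := by gcongr
    _ = (R * ‖g x‖ₑ + R ^ 2 * (2 * B)) * ‖y - x‖ₑ ^ 2 := by ring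
    _ ≤ _ := by
        gcongr
        exact le_add_self

end Consequences

/-! ### The `L^q` bound for the opening function -/

section NormBounds

theorem eLpNorm_const_mul_le {α : Type*} [MeasurableSpace α] {μ : Measure α} {c : ℝ≥0∞}
    (hc : c ≠ ⊤) (f : α → ℝ≥0∞) (p : ℝ≥0∞) :
    eLpNorm (fun x => c * f x) p μ ≤ c * eLpNorm f p μ := by
  have := eLpNorm_le_nnreal_smul_eLpNorm_of_ae_le_mul' (μ := μ) (f := fun x => c * f x) (g := f)
    (c := c.toNNReal) (Eventually.of_forall fun x => by simp [ENNReal.coe_toNNReal hc]) p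
  rwa [ENNReal.smul_def, smul_eq_mul, ENNReal.coe_toNNReal hc] at this

/-- The expansions give a sup bound by the Sobolev norm; inserted in the pointwise bound for the
opening function, it leaves only terms whose `L^q` norms are known. -/
theorem IsBoundedC11Domain.exists_eLpNorm_Theta_le {n : ℕ} (hn : 2 ≤ n) {q : ℝ}
    (hq : (n : ℝ) / 2 < q) {Ω : Opens (EuclideanSpace ℝ (Fin n))}
    (hΩ : IsBoundedC11Domain (Ω : Set (EuclideanSpace ℝ (Fin n)))) :
    ∃ C : ℝ≥0, ∀ u : EuclideanSpace ℝ (Fin n) → ℝ, MemSobolev Ω 2 (ENNReal.ofReal q) u →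
      (∃ v, ContinuousOn v Ω ∧ v =ᵐ[volume.restrict Ω] u) ∧
      ∀ v : EuclideanSpace ℝ (Fin n) → ℝ, ContinuousOn v Ω → v =ᵐ[volume.restrict Ω] u →
        eLpNorm (Theta v Ω) (ENNReal.ofReal q) (volume.restrict Ω) ≤
          C * sobolevNorm Ω 2 (ENNReal.ofReal q) u := by
  have hn' : (2 : ℝ) ≤ n := by exact_mod_cast hn
  have hq0 : 0 < q := by linarith
  obtain ⟨r, hr, C, hC⟩ := hΩ.exists_hasTaylorExpansions hn hq
  obtain ⟨m, hm0, hm⟩ := exists_le_volume_ball_inter hΩ.isOpen hΩ.isBounded hr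
  set Q := ENNReal.ofReal q with hQ
  have hQ1 : 1 ≤ Q := ENNReal.one_le_ofReal.2 (by linarith)
  have hQ0 : Q ≠ 0 := (zero_lt_one.trans_le hQ1).ne'
  have hQt : Q.toReal = q := ENNReal.toReal_ofReal hq0.le
  have hfin : volume (Ω : Set (EuclideanSpace ℝ (Fin n))) ≠ ⊤ := hΩ.isBounded.measure_lt_top.ne
  have hmt : m ≠ ⊤ := by
    obtain ⟨y, hy⟩ := hΩ.isConnected.nonempty
    exact ((hm y hy).trans_lt ((measure_mono inter_subset_right).trans_lt hfin.lt_top)).ne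
  set ν := volume.restrict (Ω : Set (EuclideanSpace ℝ (Fin n))) with hν
  set R := ENNReal.ofReal r with hR
  set R' := ENNReal.ofReal r⁻¹ with hR'
  have hRt : R ≠ ⊤ := ENNReal.ofReal_ne_top
  have hRt' : R' ≠ ⊤ := ENNReal.ofReal_ne_top
  set κ₁ := volume (Ω : Set (EuclideanSpace ℝ (Fin n))) ^ (1 - 1 / q) with hκ₁
  set κ₂ := volume (Ω : Set (EuclideanSpace ℝ (Fin n))) ^ (1 / q) with hκ₂
  have hκ₁t : κ₁ ≠ ⊤ := by
    refine ENNReal.rpow_ne_top_of_nonneg (sub_nonneg.2 ?_) hfin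
    rw [div_le_one hq0]
    linarith
  have hκ₂t : κ₂ ≠ ⊤ := ENNReal.rpow_ne_top_of_nonneg (by positivity) hfin
  -- Sup bound constant: the three terms come from `u`, its gradient and the Taylor error, `κ₁` from
  -- Hölder between `L^1` and `L^q`, and `m` from averaging.
  set K := (1 + R * C + R ^ 2 * C) * κ₁ / m with hK
  have hKt : K ≠ ⊤ := ENNReal.div_ne_top (by finiteness) hm0
  set D := 2 * (C + R' * C + R' ^ 2 * (2 * K) * κ₂) with hD
  have hDt : D ≠ ⊤ := by finiteness
  refine ⟨D.toNNReal, fun u hu => ?_⟩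
  rw [ENNReal.coe_toNNReal hDt]
  obtain ⟨G, g, A, h, hgm, hAm, hgN, hAN⟩ := hC u hu
  set N := sobolevNorm Ω 2 Q u with hN
  have hNt : N ≠ ⊤ := hu.sobolevNorm_lt_top.ne
  have huN : eLpNorm u Q ν ≤ N := hu.eLpNorm_le_sobolevNorm
  have hAs : AEStronglyMeasurable A ν := hAm.aestronglyMeasurable
  have hgs : ∀ c : ℝ≥0∞, AEStronglyMeasurable (fun x => c * ‖g x‖ₑ) ν := fun c =>
    (hgm.enorm.const_mul c).aestronglyMeasurable
  have hgc : ∀ c : ℝ≥0∞, c ≠ ⊤ → eLpNorm (fun x => c * ‖g x‖ₑ) Q ν ≤ c * (C * N) := fun c hc =>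
    (eLpNorm_const_mul_le hc _ Q).trans (by rw [eLpNorm_enorm]; gcongr)
  have hAc : ∀ c : ℝ≥0∞, c ≠ ⊤ → eLpNorm (fun x => c * A x) Q ν ≤ c * (C * N) := fun c hc =>
    (eLpNorm_const_mul_le hc _ Q).trans (by gcongr)
  refine ⟨h.exists_continuousOn hΩ.isOpen hr hq0 hq ?_, fun v hv hvu => ?_⟩
  · have h1 : eLpNorm A Q ν ≠ ⊤ := (hAN.trans_lt (by finiteness)).ne
    rw [eLpNorm_eq_lintegral_rpow_enorm_toReal hQ0 ENNReal.ofReal_ne_top, hQt] at h1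
    simpa [ENNReal.rpow_eq_top_iff, hq0, hq0.not_gt] using h1
  have hB : ∀ y ∈ (Ω : Set (EuclideanSpace ℝ (Fin n))), ‖v y‖ₑ ≤ K * N := by
    intro y hy
    have h1 := h.mul_enorm_le hΩ.isOpen hv hvu hm hy
    set W : EuclideanSpace ℝ (Fin n) → ℝ≥0∞ := fun x => ‖u x‖ₑ + R * ‖g x‖ₑ + R ^ 2 * A x with hW
    have hus : AEStronglyMeasurable (fun x => ‖u x‖ₑ) ν := hu.memLp.1.enorm.aestronglyMeasurable
    have hWs : AEStronglyMeasurable W ν :=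
      (hus.add (hgs R)).add (hAm.const_mul (R ^ 2)).aestronglyMeasurable
    have hWQ : eLpNorm W Q ν ≤ N + R * (C * N) + R ^ 2 * (C * N) := by
      refine (eLpNorm_add_le (hus.add (hgs R)) (hAm.const_mul (R ^ 2)).aestronglyMeasurable
        hQ1).trans (add_le_add ?_ (hAc _ (by finiteness)))
      refine (eLpNorm_add_le hus (hgs R) hQ1).trans (add_le_add ?_ (hgc _ hRt))
      rwa [eLpNorm_enorm]
    have hW1 : ∫⁻ x, W x ∂ν ≤ eLpNorm W Q ν * κ₁ := by
      have := eLpNorm_le_eLpNorm_mul_rpow_measure_univ (μ := ν) hQ1 hWs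
      rw [eLpNorm_one_eq_lintegral_enorm, hQt, ENNReal.toReal_one, div_one, hν,
        Measure.restrict_apply_univ] at this
      simpa only [enorm_eq_self] using this
    have h2 : ‖v y‖ₑ ≤ (∫⁻ x, W x ∂ν) / m := by
      rwa [ENNReal.le_div_iff_mul_le (Or.inl hm0) (Or.inl hmt), mul_comm]
    calc ‖v y‖ₑ ≤ (N + R * (C * N) + R ^ 2 * (C * N)) * κ₁ / m :=
          h2.trans (ENNReal.div_le_div_right (hW1.trans (by gcongr)) m)
      _ = K * N := by
          rw [hK, div_eq_mul_inv, div_eq_mul_inv]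
          ring
  have hΘ := h.ae_Theta_le hΩ.isOpen hr hv hvu hB
  set T : EuclideanSpace ℝ (Fin n) → ℝ≥0∞ :=
    fun x => A x + R' * ‖g x‖ₑ + R' ^ 2 * (2 * (K * N)) with hT
  have hTQ : eLpNorm T Q ν ≤ C * N + R' * (C * N) + R' ^ 2 * (2 * (K * N)) * κ₂ := by
    refine (eLpNorm_add_le (hAs.add (hgs R')) aestronglyMeasurable_const hQ1).trans
      (add_le_add ((eLpNorm_add_le hAs (hgs R') hQ1).trans (add_le_add hAN (hgc _ hRt'))) ?_)
    rw [eLpNorm_const' _ hQ0 ENNReal.ofReal_ne_top, hQt, hν, Measure.restrict_apply_univ,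
      enorm_eq_self]
  calc eLpNorm (Theta v Ω) Q ν ≤ eLpNorm (fun x => 2 * T x) Q ν :=
        eLpNorm_mono_enorm_ae (by simpa using hΘ)
    _ ≤ 2 * (C * N + R' * (C * N) + R' ^ 2 * (2 * (K * N)) * κ₂) :=
        (eLpNorm_const_mul_le (by simp) T Q).trans (by gcongr)
    _ = D * N := by rw [hD]; ring

end NormBounds

end ThetaOpening

theorem mainTheorem3 (n : ℕ) (hn : 2 ≤ n) (q : ℝ) (hq : (n : ℝ) / 2 < q)
    (Ω : TopologicalSpace.Opens (EuclideanSpace ℝ (Fin n)))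
    (hΩ : ThetaOpening.IsBoundedC11Domain (Ω : Set (EuclideanSpace ℝ (Fin n)))) :
    ∃ C : ℝ≥0, ∀ u : EuclideanSpace ℝ (Fin n) → ℝ,
      ThetaOpening.MemSobolev Ω 2 (ENNReal.ofReal q) u →
        (∃ v : EuclideanSpace ℝ (Fin n) → ℝ,
          ContinuousOn v Ω ∧ v =ᵐ[MeasureTheory.volume.restrict Ω] u) ∧
        ∀ v : EuclideanSpace ℝ (Fin n) → ℝ,
          ContinuousOn v Ω → v =ᵐ[MeasureTheory.volume.restrict Ω] u →
            MeasureTheory.MemLp (ThetaOpening.Theta v Ω) (ENNReal.ofReal q)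
              (MeasureTheory.volume.restrict Ω) ∧
            MeasureTheory.eLpNorm (ThetaOpening.Theta v Ω) (ENNReal.ofReal q)
              (MeasureTheory.volume.restrict Ω)
              ≤ C * ThetaOpening.sobolevNorm Ω 2 (ENNReal.ofReal q) u := by
  obtain ⟨C, hC⟩ := hΩ.exists_eLpNorm_Theta_le hn hq
  refine ⟨C, fun u hu => ⟨(hC u hu).1, fun v hv hvu => ?_⟩⟩
  have h := (hC u hu).2 v hv hvu
  exact ⟨⟨ThetaOpening.aestronglyMeasurable_Theta hΩ.isOpen hv,
    h.trans_lt (ENNReal.mul_lt_top ENNReal.coe_lt_top hu.sobolevNorm_lt_top)⟩, h⟩
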